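/- Let $\Phi(x)=\frac1{\sqrt{2\pi}}\int_{-\infty}^x e^{-u^2/2}\,du$. Let $C_3$ denote the least absolute constant $C$ such that, for every $n\ge 1$ and all independent, centered, non-degenerate real random variables $\xi_1,\dots,\xi_n$ with $\mathbf E|\xi_i|^3<\infty$, $$\sup_{x\in\mathbf R}\Big|\mathbf P\Big(\sum_{i=1}^n\xi_i\le x\sigma\Big)-\Phi(x)\Big|\le C\,\frac{\sum_{i=1}^n\mathbf E|\xi_i|^3}{\sigma^3},\qquad \sigma^2=\sum_{i=1}^n\mathbf E\xi_i^2 .$$ **Theorem 2.2.** Let $\xi_1,\dots,\xi_n$ be independent non-degenerate real random variables with $\mathbf E\xi_i=0$, and put $\sigma_i=(\mathbf E\xi_i^2)^{1/2}$, $\sigma^2=\sum_{i=1}^n\sigma_i^2$, $\sigma>0$, $S_n=\sum_{i=1}^n\xi_i$. Assume that, for some constant $B>0$ and all $1\le i\le n$, $\xi_i\le\sigma_i$ almost surely and $\mathbf E|\xi_i|^3\le B\,\mathbf E\xi_i^2<\infty$. Then, for all $0\le x<0.25\,\sigma/B$, $$\mathbf P(S_n>x\sigma)\le\big(1-\Phi(x)\big)\Big[1+c_x\,(1+x)\frac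 B\sigma\Big],$$ where $$c_x=\frac{e^{t+t^2}}{1-t}\left(\sqrt2+\frac{16\sqrt{2\pi}\,C_3\,e^{t^2/2}}{(1-t)^{1/2}}\right),\qquad t=\frac{2xB/\sigma}{1+\sqrt{1-4xB/\sigma}} .$$ In particular, let $(\xi_i)_{i\ge1}$ be an i.i.d. sequence of centered, non-degenerate real random variables with $\xi_1\le\sigma_1$ almost surely and $\mathbf E|\xi_1|^3\le B\,\mathbf E\xi_1^2<\infty$ for some $B>0$, and let $\sigma=\sqrt n\,\sigma_1$. Then for $0\le x=o(\sqrt n)$, $$\mathbf P(S_n>x\sigma)\le\big(1-\Phi(x)\big)\big[1+o(1)\big]\qquad(n\to\infty);$$ that is, for every real sequence $(a_n)$ with $a_n=o(\sqrt n)$ there is a sequence $\varepsilon_n\to0$ such that $\mathbf P(S_n>x\sigma)\le(1-\Phi(x))(1+\varepsilon_n)$ for all $n\ge 1$ and all $0\le x\le a_n$. -/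

import Mathlib

open MeasureTheory ProbabilityTheory Filter Asymptotics

noncomputable section

namespace SubGaussianTail

/-- The standard normal distribution function `Φ`. -/
def Phi (x : ℝ) : ℝ := cdf (gaussianReal 0 1) x

/-- A random variable is non-degenerate if it is not almost surely constant. -/
def NonDegenerate {Ω : Type*} [MeasurableSpace Ω] (μ : Measure Ω) (X : Ω → ℝ) : Prop :=
  ¬ ∃ c : ℝ, ∀ᵐ ω ∂μ, X ω = c

/-- The standard deviation `(E X²)^{1/2}` of a centered random variable `X`. -/
def sd {Ω : Type*} [MeasurableSpace Ω] (μ : Measure Ω) (X : Ω → ℝ) : ℝ :=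
  √(∫ ω, X ω ^ 2 ∂μ)

/-- `σ = (∑ E ξᵢ²)^{1/2}`, the standard deviation of a sum of independent centered variables. -/
def sdSum {Ω : Type*} [MeasurableSpace Ω] (μ : Measure Ω) {n : ℕ} (ξ : Fin n → Ω → ℝ) : ℝ :=
  √(∑ i, ∫ ω, ξ i ω ^ 2 ∂μ)

/-- `C` is an admissible absolute constant in the Berry-Esseen inequality for sums of `n ≥ 1`
independent, centered, non-degenerate, not necessarily identically distributed random variables
with finite third absolute moments. (The inequality only involves the joint law on `ℝⁿ`, so
nothing is lost by taking the sample space in `Type`.) -/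
def IsBerryEsseenConstant (C : ℝ) : Prop :=
  ∀ (Ω : Type) [MeasurableSpace Ω] (μ : Measure Ω) [IsProbabilityMeasure μ]
    (n : ℕ) (ξ : Fin n → Ω → ℝ), 0 < n →
    (∀ i, Measurable (ξ i)) → iIndepFun ξ μ →
    (∀ i, NonDegenerate μ (ξ i)) →
    (∀ i, Integrable (fun ω => |ξ i ω| ^ 3) μ) →
    (∀ i, ∫ ω, ξ i ω ∂μ = 0) →
    ∀ x : ℝ, |μ.real {ω | ∑ i, ξ i ω ≤ x * sdSum μ ξ} - Phi x|
      ≤ C * ((∑ i, ∫ ω, |ξ i ω| ^ 3 ∂μ) / sdSum μ ξ ^ 3)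

/-- The Lyapunov constant `C₃`: the least admissible constant. -/
def C3 : ℝ := sInf {C : ℝ | IsBerryEsseenConstant C}

/-- `t` as a function of `u = x B / σ`. -/
def tParam (u : ℝ) : ℝ := 2 * u / (1 + √(1 - 4 * u))

/-- The explicit factor `c_x`, as a function of `t`. -/
def cFactor (t : ℝ) : ℝ :=
  Real.exp (t + t ^ 2) / (1 - t) *
    (√2 + 16 * √(2 * Real.pi) * C3 * Real.exp (1 / 2 * t ^ 2) / √(1 - t))

end SubGaussianTail

end

/-!
The proof is a saddle-point argument. Tilt the law of each summand by `exp (l x)`, with `l ≥ 0`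
chosen so that the tilted means add up to `x σ` (`exists_saddle`). Then
`P(S > x σ) = E exp (l (S - x σ)) * E_l [exp (-l (S - x σ)) 1_{S > x σ}]` (`tail_eq_tilted`).

* Because `ξᵢ ≤ σᵢ`, exponential moments are at most those of a symmetric two-point law, hence
  sub-Gaussian: `E exp (l ξᵢ) ≤ exp (l² σᵢ² / 2)` (`Summand.mgf_le`). By convexity, the choice of
  `l` minimizes `E exp (l (S - x σ))`, so this factor is at most `exp (-x² / 2)`
  (`prod_mgf_le`).
* Under the tilted law `S - x σ` is a centered sum of independent variables, to which the
  Berry–Esseen inequality with constant `C₃` applies. With `T` its standard deviation and `mills`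
  the Mills ratio, the second factor is at most `mills (l T) / √(2π)` plus twice the Berry–Esseen
  error (`tilted_integral_le`, `integral_expPos_le`). Moment bounds for the tilted laws control
  that error and show that `l T` is not much smaller than `x` (`mean_bound_le`). Since
  `y ↦ y * mills y` is increasing, this suffices to compare `mills (l T)` with `mills x`
  (`mills_le_of_le_mul`), and `exp (-x² / 2) * mills x / √(2π)` is `1 - Φ(x)`.

The argument needs `C₃` to be an admissible constant itself, that is, that some admissible
constant exists (otherwise `C₃` would be the junk value `0` of an infimum over the empty set). So
the Berry–Esseen inequality for non-identically distributed summands is proved here, by Stein's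
method: `E f'(W) - E W f(W)` is expanded summand by summand for the solution `f` of Stein's
equation for a half-line, and the jump of `f'` is handled by a concentration inequality for the sum
with one summand removed (`concentration`, `abs_stein_term_le`, `berryEsseen_normalized`).
-/

noncomputable section

namespace SubGaussianTail

/-! ### The Mills ratio of the standard normal law -/

lemma gaussianPDFReal_std (u : ℝ) :
    gaussianPDFReal 0 1 u = (√(2 * Real.pi))⁻¹ * Real.exp (-u ^ 2 / 2) := by
  simp [gaussianPDFReal_def]

lemma sqrt_two_pi_pos : 0 < √(2 * Real.pi) := Real.sqrt_pos.2 (by positivity)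

/-- The Mills ratio `(1 - Φ(y)) / Φ'(y)`, written as the Laplace transform
`∫₀^∞ exp (-y u - u² / 2) du` of the Gaussian weight on the half-line. -/
def mills (y : ℝ) : ℝ := ∫ u in Set.Ioi (0 : ℝ), Real.exp (-(y * u) - u ^ 2 / 2)

lemma integrable_mills (y : ℝ) : Integrable (fun u : ℝ => Real.exp (-(y * u) - u ^ 2 / 2)) := by
  have h := (integrable_exp_neg_mul_sq (b := 1 / 2) (by norm_num)).comp_add_right y
  refine (h.const_mul (Real.exp (y ^ 2 / 2))).congr (ae_of_all _ fun u => ?_)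
  simp only [← Real.exp_add]
  congr 1; ring

lemma Phi_eq_measure (x : ℝ) : Phi x = (gaussianReal 0 1).real (Set.Iic x) := by
  rw [Phi, cdf_eq_real]

lemma one_sub_Phi_eq_measure (x : ℝ) : 1 - Phi x = (gaussianReal 0 1).real (Set.Ioi x) := by
  rw [Phi_eq_measure, ← Set.compl_Iic, measureReal_compl measurableSet_Iic]
  simp

lemma gaussian_real_eq_integral (s : Set ℝ) :
    (gaussianReal 0 1).real s = ∫ u in s, gaussianPDFReal 0 1 u := by
  rw [Measure.real, gaussianReal_apply_eq_integral _ one_ne_zero, ENNReal.toReal_ofReal]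
  exact integral_nonneg fun u => gaussianPDFReal_nonneg 0 1 u

lemma one_sub_Phi_eq (x : ℝ) :
    1 - Phi x = Real.exp (-x ^ 2 / 2) * mills x / √(2 * Real.pi) := by
  rw [one_sub_Phi_eq_measure, gaussian_real_eq_integral]
  have h := (measurePreserving_add_right (volume : Measure ℝ) x).setIntegral_preimage_emb
    (measurableEmbedding_addRight x) (fun u => gaussianPDFReal 0 1 u) (Set.Ioi x)
  rw [← h]
  have hs : (fun u : ℝ => u + x) ⁻¹' Set.Ioi x = Set.Ioi 0 := by ext u; simp
  rw [hs, mills, div_eq_inv_mul, ← integral_const_mul, ← integral_const_mul]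
  refine integral_congr_ae (ae_of_all _ fun u => ?_)
  simp only [gaussianPDFReal_std, ← Real.exp_add]
  congr 2; ring

lemma mills_pos (y : ℝ) : 0 < mills y := by
  refine (setIntegral_pos_iff_support_of_nonneg_ae (ae_of_all _ fun u => (Real.exp_pos _).le)
    (integrable_mills y).integrableOn).2 ?_
  have : Function.support (fun u : ℝ => Real.exp (-(y * u) - u ^ 2 / 2)) = Set.univ := by
    ext u; simp [Real.exp_ne_zero]
  rw [this]; simp

lemma mills_antitone : Antitone mills := by
  intro x y hxy
  refine setIntegral_mono_on (integrable_mills y).integrableOn (integrable_mills x).integrableOn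
    measurableSet_Ioi fun u hu => ?_
  have hu : (0 : ℝ) < u := hu
  gcongr

lemma mills_zero : mills 0 = √(Real.pi / (1 / 2)) / 2 := by
  rw [← integral_gaussian_Ioi, mills]
  refine integral_congr_ae (ae_of_all _ fun u => ?_)
  simp only; congr 1; ring

lemma mills_zero_le : mills 0 ≤ 2 := by
  rw [mills_zero]
  have : √(Real.pi / (1 / 2)) ≤ 4 := Real.sqrt_le_iff.2 ⟨by norm_num, by
    have := Real.pi_lt_d2; linarith⟩
  linarith

lemma one_le_mills_zero : 1 ≤ mills 0 := by
  rw [mills_zero]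
  have : 2 ≤ √(Real.pi / (1 / 2)) := Real.le_sqrt_of_sq_le (by
    have := Real.pi_gt_d2; linarith)
  linarith

lemma mul_mills_eq {y : ℝ} (hy : 0 < y) :
    y * mills y = ∫ v in Set.Ioi (0 : ℝ), Real.exp (-v - v ^ 2 / (2 * y ^ 2)) := by
  have h := integral_comp_mul_left_Ioi
    (fun v : ℝ => Real.exp (-v - v ^ 2 / (2 * y ^ 2))) 0 hy
  simp only [mul_zero, smul_eq_mul] at h
  have h2 : mills y = y⁻¹ * ∫ v in Set.Ioi (0 : ℝ), Real.exp (-v - v ^ 2 / (2 * y ^ 2)) := by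
    rw [← h, mills]
    refine integral_congr_ae (ae_of_all _ fun u => ?_)
    simp only; congr 1; field_simp
  rw [h2, mul_inv_cancel_left₀ hy.ne']

lemma integrableOn_mul_mills {y : ℝ} (hy : 0 < y) :
    IntegrableOn (fun v : ℝ => Real.exp (-v - v ^ 2 / (2 * y ^ 2))) (Set.Ioi 0) := by
  refine Integrable.mono' (g := fun v => Real.exp (-v))
    (integrableOn_exp_neg_Ioi 0) (by fun_prop) (ae_of_all _ fun v => ?_)
  rw [Real.norm_eq_abs, Real.abs_exp]
  have : 0 ≤ v ^ 2 / (2 * y ^ 2) := by positivity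
  exact Real.exp_le_exp.2 (by linarith)

lemma mul_mills_mono {x y : ℝ} (hy : 0 < y) (hyx : y ≤ x) : y * mills y ≤ x * mills x := by
  have hx := hy.trans_le hyx
  rw [mul_mills_eq hy, mul_mills_eq hx]
  refine setIntegral_mono_on (integrableOn_mul_mills hy) (integrableOn_mul_mills hx)
    measurableSet_Ioi fun u hu => ?_
  gcongr

lemma mul_mills_le_one (y : ℝ) : y * mills y ≤ 1 := by
  rcases le_or_gt y 0 with hy | hy
  · exact (mul_nonpos_of_nonpos_of_nonneg hy (mills_pos y).le).trans zero_le_one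
  · rw [mul_mills_eq hy, ← integral_exp_neg_Ioi_zero]
    refine setIntegral_mono_on (integrableOn_mul_mills hy)
      (by simpa using integrableOn_exp_neg_Ioi 0) measurableSet_Ioi fun v _ => ?_
    have : 0 ≤ v ^ 2 / (2 * y ^ 2) := by positivity
    exact Real.exp_le_exp.2 (by linarith)

lemma integrableOn_mul_exp (x : ℝ) :
    IntegrableOn (fun u : ℝ => u * Real.exp (-(x * u) - u ^ 2 / 2)) (Set.Ioi 0) := by
  refine Integrable.mono' (integrable_mills (x - 1)).integrableOn (by fun_prop) ?_
  filter_upwards [ae_restrict_mem measurableSet_Ioi] with u hu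
  have hu : (0 : ℝ) < u := hu
  rw [Real.norm_eq_abs, abs_of_nonneg (by positivity)]
  have h1 : u ≤ Real.exp u := by linarith [Real.add_one_le_exp u]
  have h2 : Real.exp (-((x - 1) * u) - u ^ 2 / 2)
      = Real.exp u * Real.exp (-(x * u) - u ^ 2 / 2) := by
    rw [← Real.exp_add]; congr 1; ring
  rw [h2]
  gcongr

lemma integral_mul_exp (x : ℝ) :
    ∫ u in Set.Ioi (0 : ℝ), u * Real.exp (-(x * u) - u ^ 2 / 2) = 1 - x * mills x := by
  have key : ∫ u in Set.Ioi (0 : ℝ), (x + u) * Real.exp (-(x * u) - u ^ 2 / 2) = 1 := by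
    have hint : IntegrableOn (fun u => (x + u) * Real.exp (-(x * u) - u ^ 2 / 2))
        (Set.Ioi 0) := by
      simp only [add_mul]
      exact ((integrable_mills x).integrableOn.const_mul x).add (integrableOn_mul_exp x)
    have h := integral_Ioi_of_hasDerivAt_of_tendsto (a := (0 : ℝ)) (m := 0)
      (f := fun u => -Real.exp (-(x * u) - u ^ 2 / 2))
      (f' := fun u => (x + u) * Real.exp (-(x * u) - u ^ 2 / 2))
      (by fun_prop) (fun u _ => ?_) hint ?_
    · rw [h]; simp
    · have h1 : HasDerivAt (fun u : ℝ => -(x * u) - u ^ 2 / 2) (-(x + u)) u := by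
        have := (((hasDerivAt_id' u).const_mul x).fun_neg).fun_sub
          ((hasDerivAt_pow 2 u).div_const 2)
        exact this.congr_deriv (by norm_num; ring)
      exact h1.exp.fun_neg.congr_deriv (by ring)
    · rw [← neg_zero]
      refine (Real.tendsto_exp_atBot.comp ?_).neg
      refine tendsto_atBot_mono' atTop ?_ tendsto_neg_atTop_atBot
      filter_upwards [eventually_ge_atTop (2 * (1 + |x|))] with u hu
      have h0 : 0 ≤ u := le_trans (by positivity) hu
      have := neg_abs_le x
      nlinarith [mul_le_mul_of_nonneg_right this h0]
  simp only [add_mul] at key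
  rw [integral_add ((integrable_mills x).integrableOn.const_mul x) (integrableOn_mul_exp x),
    integral_const_mul] at key
  rw [mills]; linarith

lemma one_le_one_add_mul_mills {x : ℝ} (hx : 0 ≤ x) : 1 ≤ (1 + x) * mills x := by
  have h1 : ∫ u in Set.Ioi (0 : ℝ),
      Real.exp (-x) * ((1 - u) * Real.exp (-(0 * u) - u ^ 2 / 2)) ≤
      ∫ u in Set.Ioi (0 : ℝ), (1 - u) * Real.exp (-(x * u) - u ^ 2 / 2) := by
    refine setIntegral_mono_on ?_ ?_ measurableSet_Ioi fun u hu => ?_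
    · simp only [sub_mul, one_mul]
      exact ((integrable_mills 0).integrableOn.sub (integrableOn_mul_exp 0)).const_mul _
    · simp only [sub_mul, one_mul]
      exact (integrable_mills x).integrableOn.sub (integrableOn_mul_exp x)
    · -- `1 - u` and `exp (-x u) - exp (-x)` have the same sign
      have e1 : Real.exp (-(x * u) - u ^ 2 / 2)
          = Real.exp (-(x * u)) * Real.exp (-(u ^ 2 / 2)) := by
        rw [← Real.exp_add]; congr 1
      have e2 : Real.exp (-(0 * u) - u ^ 2 / 2) = Real.exp (-(u ^ 2 / 2)) := by
        congr 1; ring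
      rw [e1, e2]
      have h3 : 0 ≤ (1 - u) * (Real.exp (-(x * u)) - Real.exp (-x)) := by
        rcases le_total u 1 with h | h
        · exact mul_nonneg (by linarith) (sub_nonneg.2 (Real.exp_le_exp.2 (by nlinarith)))
        · exact mul_nonneg_of_nonpos_of_nonpos (by linarith)
            (sub_nonpos.2 (Real.exp_le_exp.2 (by nlinarith)))
      nlinarith [mul_nonneg h3 (Real.exp_pos (-(u ^ 2 / 2))).le]
  rw [integral_const_mul] at h1
  simp only [sub_mul, one_mul] at h1
  rw [integral_sub (by simpa using (integrable_mills 0).restrict)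
      (by simpa [IntegrableOn] using integrableOn_mul_exp 0),
    integral_sub (integrable_mills x).integrableOn (integrableOn_mul_exp x),
    integral_mul_exp x] at h1
  have h0 := integral_mul_exp 0
  simp only [zero_mul] at h0 h1
  rw [h0] at h1
  have h2 : ∫ u in Set.Ioi (0 : ℝ), Real.exp (-0 - u ^ 2 / 2) = mills 0 := by simp [mills]
  rw [h2] at h1
  have h3 := mul_nonneg (Real.exp_pos (-x)).le (sub_nonneg.2 one_le_mills_zero)
  have h4 : ∫ u in Set.Ioi (0 : ℝ), Real.exp (-(x * u) - u ^ 2 / 2) = mills x := rfl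
  rw [h4] at h1
  linarith

lemma Phi_lt_one (x : ℝ) : Phi x < 1 := by
  have h := one_sub_Phi_eq x
  have : 0 < Real.exp (-x ^ 2 / 2) * mills x / √(2 * Real.pi) :=
    div_pos (mul_pos (Real.exp_pos _) (mills_pos x)) sqrt_two_pi_pos
  linarith

lemma Phi_neg (x : ℝ) : Phi (-x) = 1 - Phi x := by
  have h : (gaussianReal 0 1).map (fun y => -y) = gaussianReal 0 1 := by
    rw [gaussianReal_map_neg]; simp
  rw [one_sub_Phi_eq_measure, gaussian_real_eq_integral, ← integral_Ici_eq_integral_Ioi,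
    ← gaussian_real_eq_integral]
  conv_rhs => rw [← h]
  rw [measureReal_def, Measure.map_apply measurable_neg measurableSet_Ici, Phi_eq_measure,
    measureReal_def]
  congr 2; ext y; simp

lemma Phi_pos (x : ℝ) : 0 < Phi x := by
  have := Phi_neg (-x); have := Phi_lt_one (-x); rw [neg_neg] at *; linarith

lemma Phi_eq (x : ℝ) : Phi x = Real.exp (-x ^ 2 / 2) * mills (-x) / √(2 * Real.pi) := by
  have h := one_sub_Phi_eq (-x)
  rw [Phi_neg] at h
  rw [neg_sq] at h
  linarith

lemma Phi_mono : Monotone Phi := monotone_cdf _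

lemma hasDerivAt_Phi (x : ℝ) :
    HasDerivAt Phi ((√(2 * Real.pi))⁻¹ * Real.exp (-x ^ 2 / 2)) x := by
  have hP : Phi = fun y => Phi 0 + ∫ u in (0 : ℝ)..y, gaussianPDFReal 0 1 u := by
    ext y
    have hi := integrable_gaussianPDFReal 0 1
    rw [← intervalIntegral.integral_Iic_sub_Iic hi.integrableOn hi.integrableOn,
      Phi_eq_measure, Phi_eq_measure, gaussian_real_eq_integral, gaussian_real_eq_integral]
    ring
  have hc : Continuous (gaussianPDFReal 0 1) := by
    have : gaussianPDFReal 0 1 = fun u => (√(2 * Real.pi))⁻¹ * Real.exp (-u ^ 2 / 2) :=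
      funext gaussianPDFReal_std
    rw [this]; fun_prop
  rw [hP, ← gaussianPDFReal_std]
  exact (intervalIntegral.integral_hasDerivAt_right (hc.intervalIntegrable _ _)
    hc.stronglyMeasurable.stronglyMeasurableAtFilter hc.continuousAt).const_add _

lemma mills_eq (y : ℝ) : mills y = √(2 * Real.pi) * (Real.exp (y ^ 2 / 2) * (1 - Phi y)) := by
  rw [one_sub_Phi_eq]
  have h : Real.exp (y ^ 2 / 2) * Real.exp (-y ^ 2 / 2) = 1 := by
    rw [← Real.exp_add, neg_div, add_neg_cancel, Real.exp_zero]
  have := sqrt_two_pi_pos.ne'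
  calc mills y = Real.exp (y ^ 2 / 2) * Real.exp (-y ^ 2 / 2) * mills y := by rw [h, one_mul]
    _ = _ := by field_simp

lemma hasDerivAt_mills (y : ℝ) : HasDerivAt mills (y * mills y - 1) y := by
  have h1 : mills = fun y => √(2 * Real.pi) * (Real.exp (y ^ 2 / 2) * (1 - Phi y)) :=
    funext mills_eq
  have h2 : HasDerivAt (fun y : ℝ => y ^ 2 / 2) y y := by
    exact ((hasDerivAt_pow 2 y).div_const 2).congr_deriv (by norm_num)
  have h3 := (h2.exp.fun_mul ((hasDerivAt_Phi y).const_sub 1)).const_mul (√(2 * Real.pi))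
  rw [h1]
  refine h3.congr_deriv ?_
  have h : Real.exp (y ^ 2 / 2) * Real.exp (-y ^ 2 / 2) = 1 := by
    rw [← Real.exp_add, neg_div, add_neg_cancel, Real.exp_zero]
  have := sqrt_two_pi_pos.ne'
  symm
  calc y * (√(2 * Real.pi) * (Real.exp (y ^ 2 / 2) * (1 - Phi y))) - 1
      = y * (√(2 * Real.pi) * (Real.exp (y ^ 2 / 2) * (1 - Phi y)))
        - √(2 * Real.pi) * (√(2 * Real.pi))⁻¹
          * (Real.exp (y ^ 2 / 2) * Real.exp (-y ^ 2 / 2)) := by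
        rw [h, mul_inv_cancel₀ this, one_mul]
    _ = _ := by ring

/-! ### The solution of Stein's equation for a half-line -/

/-- The bounded solution `f` of Stein's equation `f' w - w f w = 1_{w ≤ z} - Φ(z)`. -/
def steinSol (z w : ℝ) : ℝ := if w ≤ z then mills (-w) * (1 - Phi z) else mills w * Phi z

/-- The derivative `w f w + 1_{w ≤ z} - Φ(z)` of the solution `f = steinSol z` away from `z`,
extended to the kink `z` by the equation itself. -/
def steinDeriv (z w : ℝ) : ℝ := w * steinSol z w + ((if w ≤ z then 1 else 0) - Phi z)

lemma mills_neg_mul (w : ℝ) : mills (-w) * (1 - Phi w) = mills w * Phi w := by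
  rw [one_sub_Phi_eq, Phi_eq]; ring

lemma steinSol_nonneg (z w : ℝ) : 0 ≤ steinSol z w := by
  rw [steinSol]
  split_ifs
  · exact mul_nonneg (mills_pos _).le (sub_nonneg.2 (Phi_lt_one z).le)
  · exact mul_nonneg (mills_pos _).le (Phi_pos z).le

lemma steinSol_le_mills_neg (z w : ℝ) : steinSol z w ≤ mills (-w) := by
  have h1 := mills_pos (-w)
  have h2 := mills_pos w
  rw [steinSol]
  split_ifs with h
  · exact mul_le_of_le_one_right h1.le (by linarith [Phi_pos z])
  · calc mills w * Phi z ≤ mills w * Phi w :=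
          mul_le_mul_of_nonneg_left (Phi_mono (not_le.1 h).le) h2.le
      _ = mills (-w) * (1 - Phi w) := (mills_neg_mul w).symm
      _ ≤ mills (-w) := mul_le_of_le_one_right h1.le (by linarith [Phi_pos w])

lemma steinSol_le_mills (z w : ℝ) : steinSol z w ≤ mills w := by
  have h1 := mills_pos (-w)
  have h2 := mills_pos w
  rw [steinSol]
  split_ifs with h
  · calc mills (-w) * (1 - Phi z) ≤ mills (-w) * (1 - Phi w) :=
          mul_le_mul_of_nonneg_left (by linarith [Phi_mono h]) h1.le
      _ = mills w * Phi w := mills_neg_mul w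
      _ ≤ mills w := mul_le_of_le_one_right h2.le (Phi_lt_one w).le
  · exact mul_le_of_le_one_right h2.le (Phi_lt_one z).le

lemma steinSol_le_mills_abs (z w : ℝ) : steinSol z w ≤ mills |w| := by
  rcases abs_cases w with ⟨h, _⟩ | ⟨h, _⟩ <;> rw [h]
  · exact steinSol_le_mills z w
  · exact steinSol_le_mills_neg z w

lemma abs_steinSol_le (z w : ℝ) : |steinSol z w| ≤ 2 := by
  rw [abs_of_nonneg (steinSol_nonneg z w)]
  exact (steinSol_le_mills_abs z w).trans
    ((mills_antitone (abs_nonneg w)).trans mills_zero_le)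

lemma abs_mul_steinSol_le (z w : ℝ) : |w * steinSol z w| ≤ 1 := by
  rw [abs_mul, abs_of_nonneg (steinSol_nonneg z w)]
  exact (mul_le_mul_of_nonneg_left (steinSol_le_mills_abs z w) (abs_nonneg w)).trans
    (mul_mills_le_one _)

lemma abs_steinDeriv_le (z w : ℝ) : |steinDeriv z w| ≤ 2 := by
  have h1 := abs_mul_steinSol_le z w
  have h2 : |(if w ≤ z then (1 : ℝ) else 0) - Phi z| ≤ 1 := by
    have := Phi_pos z
    have := Phi_lt_one z
    rw [abs_le]
    split_ifs <;> constructor <;> linarith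
  exact (abs_add_le _ _).trans (by linarith)

lemma continuous_mills : Continuous mills :=
  continuous_iff_continuousAt.2 fun y => (hasDerivAt_mills y).continuousAt

lemma continuous_steinSol (z : ℝ) : Continuous (steinSol z) := by
  refine Continuous.if_le ?_ ?_ continuous_id continuous_const ?_
  · exact (continuous_mills.comp continuous_neg).mul continuous_const
  · exact continuous_mills.mul continuous_const
  · rintro w rfl
    exact mills_neg_mul w

lemma measurable_steinDeriv (z : ℝ) : Measurable (steinDeriv z) := by
  refine (measurable_id.mul (continuous_steinSol z).measurable).add (Measurable.sub ?_ ?_)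
  · exact Measurable.ite measurableSet_Iic measurable_const measurable_const
  · exact measurable_const

lemma hasDerivAt_steinSol {z w : ℝ} (h : w ≠ z) :
    HasDerivAt (steinSol z) (steinDeriv z w) w := by
  rcases lt_or_gt_of_ne h with h | h
  · have h1 : HasDerivAt (fun w => mills (-w) * (1 - Phi z)) (steinDeriv z w) w := by
      have := ((hasDerivAt_mills (-w)).comp w (hasDerivAt_neg w)).mul_const (1 - Phi z)
      refine this.congr_deriv ?_
      rw [steinDeriv, steinSol, if_pos h.le, if_pos h.le]; ring
    refine h1.congr_of_eventuallyEq ?_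
    filter_upwards [Iio_mem_nhds h] with u hu
    rw [steinSol, if_pos (le_of_lt hu)]
  · have h1 : HasDerivAt (fun w => mills w * Phi z) (steinDeriv z w) w := by
      refine ((hasDerivAt_mills w).mul_const (Phi z)).congr_deriv ?_
      rw [steinDeriv, steinSol, if_neg h.not_ge, if_neg h.not_ge]; ring
    refine h1.congr_of_eventuallyEq ?_
    filter_upwards [Ioi_mem_nhds h] with u hu
    rw [steinSol, if_neg (not_le.2 hu)]

lemma intervalIntegrable_steinDeriv (z a b : ℝ) :
    IntervalIntegrable (steinDeriv z) volume a b := by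
  refine (intervalIntegrable_const (c := (2 : ℝ))).mono_fun
    (measurable_steinDeriv z).aestronglyMeasurable (ae_of_all _ fun w => ?_)
  simpa using abs_steinDeriv_le z w

lemma integral_steinDeriv (z a b : ℝ) :
    ∫ u in a..b, steinDeriv z u = steinSol z b - steinSol z a :=
  integral_eq_of_hasDerivAt_off_countable _ _ (Set.countable_singleton z)
    (continuous_steinSol z).continuousOn (fun _ hu => hasDerivAt_steinSol hu.2)
    (intervalIntegrable_steinDeriv z a b)

lemma abs_steinSol_sub_le (z w x : ℝ) : |steinSol z (w + x) - steinSol z w| ≤ 2 * |x| := by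
  rw [← integral_steinDeriv]
  have := intervalIntegral.norm_integral_le_of_norm_le_const (a := w) (b := w + x) (C := 2)
    (f := steinDeriv z) (fun u _ => abs_steinDeriv_le z u)
  simpa using this

/-- The indicator of the event that a step of size `|x|` from `w` can reach `z`. -/
def nearInd (z w x : ℝ) : ℝ := if |w - z| ≤ |x| then 1 else 0

lemma nearInd_nonneg (z w x : ℝ) : 0 ≤ nearInd z w x := by
  rw [nearInd]; split_ifs <;> norm_num

lemma nearInd_le_one (z w x : ℝ) : nearInd z w x ≤ 1 := by
  rw [nearInd]; split_ifs <;> norm_num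

lemma abs_steinDeriv_sub_le (z w x : ℝ) :
    |steinDeriv z (w + x) - steinDeriv z w| ≤ 2 * (|w| + 1) * |x| + nearInd z w x := by
  have h1 : |w * (steinSol z (w + x) - steinSol z w)| ≤ |w| * (2 * |x|) := by
    rw [abs_mul]; exact mul_le_mul_of_nonneg_left (abs_steinSol_sub_le z w x) (abs_nonneg w)
  have h2 : |x * steinSol z (w + x)| ≤ |x| * 2 := by
    rw [abs_mul]; exact mul_le_mul_of_nonneg_left (abs_steinSol_le z _) (abs_nonneg x)
  have h3 : |(if w + x ≤ z then (1 : ℝ) else 0) - (if w ≤ z then 1 else 0)| ≤ nearInd z w x := by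
    rw [nearInd]
    split_ifs with a b c d e f <;> norm_num <;> apply ‹¬ (|w - z| ≤ |x|)›
    · rw [abs_of_nonneg (by linarith)]; linarith [neg_abs_le x]
    · rw [abs_of_nonpos (by linarith)]; linarith [le_abs_self x]
  have : steinDeriv z (w + x) - steinDeriv z w = w * (steinSol z (w + x) - steinSol z w)
      + x * steinSol z (w + x)
      + ((if w + x ≤ z then (1 : ℝ) else 0) - (if w ≤ z then 1 else 0)) := by
    rw [steinDeriv, steinDeriv]; ring
  rw [this]
  refine (abs_add_three _ _ _).trans ?_
  linarith

lemma nearInd_mono {z w x y : ℝ} (h : |x| ≤ |y|) : nearInd z w x ≤ nearInd z w y := by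
  rw [nearInd, nearInd]
  split_ifs with a b
  · exact le_rfl
  · exact absurd (a.trans h) b
  · exact zero_le_one
  · exact le_rfl

/-- First-order expansion of the solution. The jump of its derivative at `z` only enters through
`nearInd`. -/
lemma abs_steinSol_taylor_le (z w x : ℝ) :
    |steinSol z (w + x) - steinSol z w - x * steinDeriv z w|
      ≤ (2 * (|w| + 1) * |x| + nearInd z w x) * |x| := by
  have h1 : steinSol z (w + x) - steinSol z w - x * steinDeriv z w
      = ∫ u in w..(w + x), (steinDeriv z u - steinDeriv z w) := by
    rw [intervalIntegral.integral_sub (intervalIntegrable_steinDeriv z _ _)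
      intervalIntegrable_const, integral_steinDeriv]
    simp
  rw [h1]
  have := intervalIntegral.norm_integral_le_of_norm_le_const (a := w) (b := w + x)
    (C := 2 * (|w| + 1) * |x| + nearInd z w x)
    (f := fun u => steinDeriv z u - steinDeriv z w) (fun u hu => ?_)
  · simpa using this
  · have hu' : |u - w| ≤ |x| := by
      have := Set.abs_sub_left_of_mem_uIcc (Set.uIoc_subset_uIcc hu)
      simpa using this
    have h2 := abs_steinDeriv_sub_le z w (u - w)
    rw [add_sub_cancel] at h2
    refine h2.trans (add_le_add ?_ (nearInd_mono hu'))
    gcongr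

lemma measurable_nearInd (z : ℝ) : Measurable fun p : ℝ × ℝ => nearInd z p.1 p.2 := by
  refine Measurable.ite ?_ measurable_const measurable_const
  exact measurableSet_le (by fun_prop) (by fun_prop)

/-! ### Moments and sums of independent variables -/

lemma abs_le_one_add_cube (x : ℝ) : |x| ≤ 1 + |x| ^ 3 := by
  have := abs_nonneg x
  nlinarith [sq_nonneg (|x| - 1), mul_nonneg this (sq_nonneg (|x| - 1))]

lemma sq_le_one_add_cube (x : ℝ) : x ^ 2 ≤ 1 + |x| ^ 3 := by
  have := abs_nonneg x
  rw [← sq_abs]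
  nlinarith [sq_nonneg (|x| - 1), mul_nonneg this (sq_nonneg (|x| - 1))]

section Moments

variable {Ω : Type*} [MeasurableSpace Ω] {μ : Measure Ω}

lemma integral_sq_nonneg (X : Ω → ℝ) : 0 ≤ ∫ ω, X ω ^ 2 ∂μ :=
  integral_nonneg fun _ => sq_nonneg _

variable [IsProbabilityMeasure μ]

lemma integrable_of_cube {X : Ω → ℝ} (hX : Measurable X)
    (h3 : Integrable (fun ω => |X ω| ^ 3) μ) : Integrable X μ :=
  ((integrable_const 1).add h3).mono' hX.aestronglyMeasurable
    (ae_of_all _ fun ω => abs_le_one_add_cube (X ω))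

lemma integrable_sq_of_cube {X : Ω → ℝ} (hX : Measurable X)
    (h3 : Integrable (fun ω => |X ω| ^ 3) μ) : Integrable (fun ω => X ω ^ 2) μ :=
  ((integrable_const 1).add h3).mono' (hX.pow_const 2).aestronglyMeasurable
    (ae_of_all _ fun ω => by
      rw [Real.norm_eq_abs, abs_of_nonneg (sq_nonneg _)]; exact sq_le_one_add_cube (X ω))

lemma memLp_two_of_cube {X : Ω → ℝ} (hX : Measurable X)
    (h3 : Integrable (fun ω => |X ω| ^ 3) μ) : MemLp X 2 μ :=
  (memLp_two_iff_integrable_sq hX.aestronglyMeasurable).2 (integrable_sq_of_cube hX h3)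

lemma sqrt_cube_le {X : Ω → ℝ} (hX : Measurable X)
    (h3 : Integrable (fun ω => |X ω| ^ 3) μ) :
    √(∫ ω, X ω ^ 2 ∂μ) ^ 3 ≤ ∫ ω, |X ω| ^ 3 ∂μ := by
  set c := √(∫ ω, X ω ^ 2 ∂μ) with hc
  have hc0 : 0 ≤ c := Real.sqrt_nonneg _
  have hc2 : c ^ 2 = ∫ ω, X ω ^ 2 ∂μ := Real.sq_sqrt (integral_sq_nonneg X)
  have h : ∫ ω, 3 * c * X ω ^ 2 ∂μ ≤ ∫ ω, (2 * |X ω| ^ 3 + c ^ 3) ∂μ := by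
    refine integral_mono ((integrable_sq_of_cube hX h3).const_mul _)
      ((h3.const_mul 2).add (integrable_const _)) fun ω => ?_
    have := abs_nonneg (X ω)
    simp only
    rw [← sq_abs]
    nlinarith [mul_nonneg (add_nonneg (mul_nonneg zero_le_two this) hc0)
      (sq_nonneg (|X ω| - c))]
  rw [integral_const_mul, ← hc2, integral_add (h3.const_mul 2) (integrable_const _),
    integral_const_mul, integral_const, probReal_univ, one_smul] at h
  nlinarith

lemma integral_abs_le_sqrt {X : Ω → ℝ} (hX : Measurable X)
    (h2 : Integrable (fun ω => X ω ^ 2) μ) :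
    ∫ ω, |X ω| ∂μ ≤ √(∫ ω, X ω ^ 2 ∂μ) := by
  have h2' : MemLp X 2 μ := (memLp_two_iff_integrable_sq hX.aestronglyMeasurable).2 h2
  refine Real.le_sqrt_of_sq_le ?_
  have h := variance_nonneg (fun ω => |X ω|) μ
  rw [variance_eq_sub (by simpa using h2'.norm)] at h
  simpa using h

lemma integral_sq_mul_integral_abs_le {X : Ω → ℝ} (hX : Measurable X)
    (h3 : Integrable (fun ω => |X ω| ^ 3) μ) :
    (∫ ω, X ω ^ 2 ∂μ) * ∫ ω, |X ω| ∂μ ≤ ∫ ω, |X ω| ^ 3 ∂μ := by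
  have h1 := integral_abs_le_sqrt hX (integrable_sq_of_cube hX h3)
  have h2 : √(∫ ω, X ω ^ 2 ∂μ) ^ 2 = ∫ ω, X ω ^ 2 ∂μ := Real.sq_sqrt (integral_sq_nonneg X)
  calc (∫ ω, X ω ^ 2 ∂μ) * ∫ ω, |X ω| ∂μ
      ≤ (∫ ω, X ω ^ 2 ∂μ) * √(∫ ω, X ω ^ 2 ∂μ) :=
        mul_le_mul_of_nonneg_left h1 (integral_sq_nonneg X)
    _ = √(∫ ω, X ω ^ 2 ∂μ) ^ 3 := by rw [pow_succ, h2]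
    _ ≤ _ := sqrt_cube_le hX h3

end Moments

section Sums

variable {Ω : Type*} [MeasurableSpace Ω] {μ : Measure Ω} {ι : Type*} {X : ι → Ω → ℝ}

lemma indepFun_sum_left (hX : ∀ i, Measurable (X i)) (hind : iIndepFun X μ) {s : Finset ι} {i : ι}
    (hi : i ∉ s) : IndepFun (fun ω => ∑ j ∈ s, X j ω) (X i) μ := by
  have := hind.indepFun_finsetSum_of_notMem hX hi
  convert this using 1
  ext ω; simp

variable [IsProbabilityMeasure μ]

lemma integral_sum_sq (hX : ∀ i, Measurable (X i)) (hind : iIndepFun X μ)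
    (h3 : ∀ i, Integrable (fun ω => |X i ω| ^ 3) μ) (h0 : ∀ i, ∫ ω, X i ω ∂μ = 0)
    (s : Finset ι) :
    ∫ ω, (∑ j ∈ s, X j ω) ^ 2 ∂μ = ∑ j ∈ s, ∫ ω, X j ω ^ 2 ∂μ := by
  have h := IndepFun.variance_sum (μ := μ) (X := X) (s := s)
    (fun i _ => memLp_two_of_cube (hX i) (h3 i)) (fun i _ j _ hij => hind.indepFun hij)
  rw [variance_of_integral_eq_zero (by fun_prop)] at h
  · simp only [Finset.sum_apply] at h
    rw [h]
    exact Finset.sum_congr rfl fun i _ => variance_of_integral_eq_zero (hX i).aemeasurable (h0 i)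
  · simp only [Finset.sum_apply]
    rw [integral_finsetSum _ fun i _ => integrable_of_cube (hX i) (h3 i)]
    exact Finset.sum_eq_zero fun i _ => h0 i

lemma integrable_sum_sq (hX : ∀ i, Measurable (X i))
    (h3 : ∀ i, Integrable (fun ω => |X i ω| ^ 3) μ) (s : Finset ι) :
    Integrable (fun ω => (∑ j ∈ s, X j ω) ^ 2) μ :=
  (memLp_finsetSum s fun i _ => memLp_two_of_cube (hX i) (h3 i)).integrable_sq

/-! ### A concentration inequality for sums -/

/-- The identity shifted to the midpoint of `[a, b]` and truncated at distance `δ` outside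
`[a, b]`: the test function of the concentration inequality. -/
def clamp (a b δ w : ℝ) : ℝ :=
  max (-((b - a) / 2 + δ)) (min ((b - a) / 2 + δ) (w - (a + b) / 2))

lemma abs_clamp_le {a b δ : ℝ} (hab : a ≤ b) (hδ : 0 ≤ δ) (w : ℝ) :
    |clamp a b δ w| ≤ (b - a) / 2 + δ := by
  rw [clamp, abs_le]
  exact ⟨le_max_left _ _, max_le (by linarith) (min_le_left _ _)⟩

lemma monotone_clamp (a b δ : ℝ) : Monotone (clamp a b δ) := by
  intro x y h
  unfold clamp
  gcongr

lemma measurable_clamp (a b δ : ℝ) : Measurable (clamp a b δ) := by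
  unfold clamp; fun_prop

lemma indicator_mul_le_clamp {a b δ : ℝ} (hδ : 0 ≤ δ) (w x : ℝ) :
    (Set.Icc a b).indicator 1 w * (|x| * min δ |x|)
      ≤ x * (clamp a b δ w - clamp a b δ (w - x)) := by
  by_cases hw : w ∈ Set.Icc a b
  · rw [Set.indicator_of_mem hw]
    obtain ⟨h1, h2⟩ := hw
    have e1 : clamp a b δ w = w - (a + b) / 2 := by
      rw [clamp, min_eq_right (by linarith), max_eq_right (by linarith)]
    rw [e1]
    simp only [Pi.one_apply, one_mul]
    rcases le_total 0 x with hx | hx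
    · rw [abs_of_nonneg hx]
      refine mul_le_mul_of_nonneg_left ?_ hx
      have e2 : clamp a b δ (w - x) = max (-((b - a) / 2 + δ)) (w - x - (a + b) / 2) := by
        rw [clamp, min_eq_right (by linarith)]
      rw [e2]
      rcases max_cases (-((b - a) / 2 + δ)) (w - x - (a + b) / 2) with ⟨h, _⟩ | ⟨h, _⟩ <;> rw [h]
      · exact (min_le_left _ _).trans (by linarith)
      · exact (min_le_right _ _).trans (by linarith)
    · rw [abs_of_nonpos hx, neg_mul, ← mul_neg]
      refine mul_le_mul_of_nonpos_left ?_ hx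
      have e2 : clamp a b δ (w - x) = min ((b - a) / 2 + δ) (w - x - (a + b) / 2) := by
        rw [clamp, max_eq_right (le_min (by linarith) (by linarith))]
      rw [e2]
      rcases min_cases ((b - a) / 2 + δ) (w - x - (a + b) / 2) with ⟨h, _⟩ | ⟨h, _⟩ <;> rw [h]
      · linarith [min_le_left δ (-x)]
      · linarith [min_le_right δ (-x)]
  · rw [Set.indicator_of_notMem hw, zero_mul]
    rcases le_total 0 x with hx | hx
    · exact mul_nonneg hx (sub_nonneg.2 (monotone_clamp a b δ (by linarith)))
    · exact mul_nonneg_of_nonpos_of_nonpos hx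
        (sub_nonpos.2 (monotone_clamp a b δ (by linarith)))

lemma sq_sub_cube_le_mul_min {δ : ℝ} (hδ : 0 < δ) (x : ℝ) :
    x ^ 2 - |x| ^ 3 / (4 * δ) ≤ |x| * min δ |x| := by
  have hx := abs_nonneg x
  have h3 : 0 ≤ |x| ^ 3 / (4 * δ) := by positivity
  rw [← sq_abs]
  rcases min_cases δ |x| with ⟨h, _⟩ | ⟨h, _⟩ <;> rw [h]
  · rw [sub_le_iff_le_add, ← sub_le_iff_le_add', le_div_iff₀ (by positivity)]
    nlinarith [mul_nonneg hx (sq_nonneg (|x| - 2 * δ))]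
  · nlinarith

/-- A sum of independent centered variables with total variance in `[3/4, 1]` lies in an interval
with probability at most its length plus four times the sum of the third absolute moments. This
is obtained by testing the sum against the function `clamp`. -/
lemma concentration [DecidableEq ι] (hX : ∀ i, Measurable (X i)) (hind : iIndepFun X μ)
    (h3 : ∀ i, Integrable (fun ω => |X i ω| ^ 3) μ) (h0 : ∀ i, ∫ ω, X i ω ∂μ = 0)
    (s : Finset ι) {γ : ℝ} (hγ : 0 < γ) (hs3 : ∑ i ∈ s, ∫ ω, |X i ω| ^ 3 ∂μ ≤ γ)
    (hv1 : ∑ i ∈ s, ∫ ω, X i ω ^ 2 ∂μ ≤ 1) (hv2 : 3 / 4 ≤ ∑ i ∈ s, ∫ ω, X i ω ^ 2 ∂μ)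
    {a b : ℝ} (hab : a ≤ b) :
    μ.real {ω | ∑ j ∈ s, X j ω ∈ Set.Icc a b} ≤ (b - a) + 4 * γ := by
  set W : Ω → ℝ := fun ω => ∑ j ∈ s, X j ω with hW
  have hWm : Measurable W := by fun_prop
  set h : ℝ := (b - a) / 2 + γ with hh
  have hh0 : 0 ≤ h := by linarith
  set f := clamp a b γ with hf
  have hfm : Measurable f := measurable_clamp a b γ
  have hfb : ∀ w, |f w| ≤ h := abs_clamp_le hab hγ.le
  set η : ι → Ω → ℝ := fun j ω => |X j ω| * min γ |X j ω| with hη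
  set A : Set Ω := {ω | W ω ∈ Set.Icc a b} with hA
  have hAm : MeasurableSet A := hWm measurableSet_Icc
  have hX1 : ∀ j, Integrable (X j) μ := fun j => integrable_of_cube (hX j) (h3 j)
  have hX2 : ∀ j, Integrable (fun ω => X j ω ^ 2) μ := fun j => integrable_sq_of_cube (hX j) (h3 j)
  have hηm : ∀ j, Measurable (η j) := fun j => by
    have := hX j
    simp only [hη]; fun_prop
  have hη0 : ∀ j ω, 0 ≤ η j ω := fun j ω =>
    mul_nonneg (abs_nonneg _) (le_min hγ.le (abs_nonneg _))
  have hηle : ∀ j ω, η j ω ≤ γ * |X j ω| := fun j ω => by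
    rw [mul_comm γ]; exact mul_le_mul_of_nonneg_left (min_le_left _ _) (abs_nonneg _)
  have hηsq : ∀ j ω, η j ω ^ 2 ≤ γ ^ 2 * X j ω ^ 2 := fun j ω => by
    rw [← sq_abs (X j ω), ← mul_pow]; exact pow_le_pow_left₀ (hη0 j ω) (hηle j ω) 2
  have hηi2 : ∀ j, Integrable (fun ω => η j ω ^ 2) μ := fun j =>
    ((hX2 j).const_mul (γ ^ 2)).mono' ((hηm j).pow_const 2).aestronglyMeasurable
      (ae_of_all _ fun ω => by
        rw [Real.norm_eq_abs, abs_of_nonneg (sq_nonneg _)]; exact hηsq j ω)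
  have hηL2 : ∀ j, MemLp (η j) 2 μ := fun j =>
    (memLp_two_iff_integrable_sq (hηm j).aestronglyMeasurable).2 (hηi2 j)
  have hηi : ∀ j, Integrable (η j) μ := fun j => (hηL2 j).integrable one_le_two
  have hXf : ∀ j, ∀ g : Ω → ℝ, Measurable g → Integrable (fun ω => X j ω * f (g ω)) μ := by
    intro j g hg
    refine (hX1 j).mul_bdd (c := h) (hfm.comp hg).aestronglyMeasurable
      (ae_of_all _ fun ω => hfb _)
  -- the test function sees the whole sum only through its own size
  have up : ∫ ω, W ω * f (W ω) ∂μ ≤ h := by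
    have hW2 : Integrable (fun ω => W ω ^ 2) μ := integrable_sum_sq hX h3 s
    have e : ∫ ω, W ω ^ 2 ∂μ ≤ 1 := by
      rw [hW, integral_sum_sq hX hind h3 h0 s]; exact hv1
    have hi : Integrable (fun ω => h * ((1 + W ω ^ 2) / 2)) μ :=
      (((integrable_const 1).add hW2).div_const 2).const_mul h
    have hWi : Integrable (fun ω => W ω * f (W ω)) μ := by
      simp only [hW, Finset.sum_mul]
      exact integrable_finsetSum _ fun j _ => hXf j _ hWm
    calc ∫ ω, W ω * f (W ω) ∂μ ≤ ∫ ω, h * ((1 + W ω ^ 2) / 2) ∂μ := by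
          refine integral_mono hWi hi fun ω => ?_
          have h1 : |W ω| ≤ (1 + W ω ^ 2) / 2 := by
            rw [← sq_abs]; nlinarith [sq_nonneg (|W ω| - 1)]
          calc W ω * f (W ω) ≤ |W ω * f (W ω)| := le_abs_self _
            _ = |W ω| * |f (W ω)| := abs_mul _ _
            _ ≤ (1 + W ω ^ 2) / 2 * h :=
              mul_le_mul h1 (hfb _) (abs_nonneg _) (by positivity)
            _ = _ := mul_comm _ _
      _ ≤ h := by
          rw [integral_const_mul, integral_div, integral_add (integrable_const 1) hW2]
          simp only [integral_const, probReal_univ, one_smul]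
          nlinarith
  have term : ∀ j ∈ s, ∫ ω, A.indicator 1 ω * η j ω ∂μ ≤ ∫ ω, X j ω * f (W ω) ∂μ := by
    intro j hj
    have hWj : ∀ ω, W ω - X j ω = ∑ k ∈ s.erase j, X k ω := fun ω => by
      rw [hW]; simp only; rw [← Finset.sum_erase_add s _ hj]; ring
    have hind' : IndepFun (X j) (fun ω => f (W ω - X j ω)) μ := by
      have h1 := (indepFun_sum_left hX hind (Finset.notMem_erase j s)).symm
      have h2 := h1.comp measurable_id hfm
      simp only [hWj]
      exact h2
    have e0 : ∫ ω, X j ω * f (W ω - X j ω) ∂μ = 0 := by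
      rw [hind'.integral_fun_mul_eq_mul_integral (hX j).aestronglyMeasurable
        (hfm.comp (hWm.sub (hX j))).aestronglyMeasurable, h0 j, zero_mul]
    have e1 : ∫ ω, X j ω * (f (W ω) - f (W ω - X j ω)) ∂μ = ∫ ω, X j ω * f (W ω) ∂μ := by
      simp only [mul_sub]
      rw [integral_sub (hXf j _ hWm) (hXf j (fun ω => W ω - X j ω) (hWm.sub (hX j))), e0,
        sub_zero]
    rw [← e1]
    refine integral_mono ?_ ?_ fun ω => ?_
    · refine (hηi j).bdd_mul (c := 1) ?_ (ae_of_all _ fun ω => ?_)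
      · exact (measurable_one.indicator hAm).aestronglyMeasurable
      · by_cases hω : ω ∈ A <;> simp [hω]
    · simp only [mul_sub]
      exact (hXf j _ hWm).sub (hXf j _ (hWm.sub (hX j)))
    · exact indicator_mul_le_clamp hγ.le (W ω) (X j ω)
  -- fluctuation of `∑ η`
  set H : Ω → ℝ := fun ω => ∑ j ∈ s, η j ω with hH
  set m : ℝ := ∑ j ∈ s, ∫ ω, η j ω ∂μ with hm
  have hHi : Integrable H μ := integrable_finsetSum _ fun j _ => hηi j
  have hHL2 : MemLp H 2 μ := memLp_finsetSum s fun j _ => hηL2 j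
  have hEH : ∫ ω, H ω ∂μ = m := integral_finsetSum _ fun j _ => hηi j
  have hm2 : 1 / 2 ≤ m := by
    have h1 : ∀ j, ∫ ω, X j ω ^ 2 ∂μ - (∫ ω, |X j ω| ^ 3 ∂μ) / (4 * γ) ≤ ∫ ω, η j ω ∂μ := by
      intro j
      rw [← integral_div, ← integral_sub (hX2 j) ((h3 j).div_const _)]
      exact integral_mono ((hX2 j).sub ((h3 j).div_const _)) (hηi j) fun ω =>
        sq_sub_cube_le_mul_min hγ _
    have h2 := Finset.sum_le_sum fun j (_ : j ∈ s) => h1 j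
    rw [Finset.sum_sub_distrib, ← Finset.sum_div] at h2
    have h4 : (∑ i ∈ s, ∫ ω, |X i ω| ^ 3 ∂μ) / (4 * γ) ≤ 1 / 4 := by
      rw [div_le_iff₀ (by positivity)]; linarith
    linarith
  have hvar : ∫ ω, (H ω - m) ^ 2 ∂μ ≤ γ ^ 2 := by
    have hη_ind : iIndepFun η μ :=
      hind.comp (fun _ x => |x| * min γ |x|) (fun _ => by fun_prop)
    have h1 := IndepFun.variance_sum (μ := μ) (X := η) (s := s) (fun i _ => hηL2 i)
      (fun i _ j _ hij => hη_ind.indepFun hij)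
    have h2 : Var[∑ i ∈ s, η i; μ] = ∫ ω, (H ω - m) ^ 2 ∂μ := by
      have : (∑ i ∈ s, η i) = H := by ext ω; simp [hH]
      rw [this, variance_eq_integral hHL2.aemeasurable, hEH]
    rw [← h2, h1]
    calc ∑ i ∈ s, Var[η i; μ] ≤ ∑ i ∈ s, γ ^ 2 * ∫ ω, X i ω ^ 2 ∂μ := by
          refine Finset.sum_le_sum fun i _ => ?_
          refine (variance_le_expectation_sq (hηm i).aestronglyMeasurable).trans ?_
          rw [← integral_const_mul]
          exact integral_mono (hηi2 i) ((hX2 i).const_mul _) fun ω => hηsq i ω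
      _ ≤ γ ^ 2 := by
          rw [← Finset.mul_sum]
          exact mul_le_of_le_one_right (sq_nonneg _) hv1
  have hdev : Integrable (fun ω => (H ω - m) ^ 2) μ := (hHL2.sub (memLp_const m)).integrable_sq
  have low : 1 / 2 * μ.real A - γ ≤ ∫ ω, A.indicator 1 ω * H ω ∂μ := by
    have hpt : ∀ ω, m * A.indicator 1 ω - (γ / 2 + (H ω - m) ^ 2 / (2 * γ))
        ≤ A.indicator 1 ω * H ω := by
      intro ω
      have h1 : |H ω - m| ≤ γ / 2 + (H ω - m) ^ 2 / (2 * γ) := by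
        rw [← sub_le_iff_le_add', le_div_iff₀ (by positivity), ← sq_abs]
        nlinarith [sq_nonneg (|H ω - m| - γ)]
      have h2 : A.indicator 1 ω * (m - H ω) ≤ |H ω - m| := by
        by_cases hω : ω ∈ A
        · rw [Set.indicator_of_mem hω, Pi.one_apply, one_mul, abs_sub_comm]
          exact le_abs_self _
        · rw [Set.indicator_of_notMem hω, zero_mul]; exact abs_nonneg _
      linarith
    have hi1 : Integrable (A.indicator (1 : Ω → ℝ)) μ := (integrable_const 1).indicator hAm
    have hi2 : Integrable (fun ω => γ / 2 + (H ω - m) ^ 2 / (2 * γ)) μ :=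
      (integrable_const _).add (hdev.div_const _)
    have h1 := integral_mono
      (f := fun ω => m * A.indicator 1 ω - (γ / 2 + (H ω - m) ^ 2 / (2 * γ)))
      ((hi1.const_mul m).sub hi2) (g := fun ω => A.indicator 1 ω * H ω)
      (hHi.bdd_mul (c := 1) (measurable_one.indicator hAm).aestronglyMeasurable
        (ae_of_all _ fun ω => by by_cases hω : ω ∈ A <;> simp [hω])) hpt
    rw [integral_sub (hi1.const_mul m) hi2, integral_const_mul, integral_indicator_one hAm,
      integral_add (integrable_const _) (hdev.div_const _),
      integral_div _ (fun ω => (H ω - m) ^ 2), integral_const,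
      probReal_univ, one_smul] at h1
    have h2 : (∫ ω, (H ω - m) ^ 2 ∂μ) / (2 * γ) ≤ γ / 2 := by
      rw [div_le_iff₀ (by positivity)]; nlinarith
    have h4 : 1 / 2 * μ.real A ≤ m * μ.real A :=
      mul_le_mul_of_nonneg_right hm2 measureReal_nonneg
    linarith
  have mid : ∫ ω, A.indicator 1 ω * H ω ∂μ ≤ ∫ ω, W ω * f (W ω) ∂μ := by
    simp only [hH, hW, Finset.mul_sum, Finset.sum_mul]
    rw [integral_finsetSum _ fun j _ => ?_, integral_finsetSum _ fun j _ => hXf j _ hWm]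
    · exact Finset.sum_le_sum term
    · exact (hηi j).bdd_mul (c := 1) (measurable_one.indicator hAm).aestronglyMeasurable
        (ae_of_all _ fun ω => by by_cases hω : ω ∈ A <;> simp [hω])
  linarith

end Sums

/-! ### The Berry–Esseen inequality -/

section BerryEsseen

variable {Ω : Type*} [MeasurableSpace Ω] {μ : Measure Ω} [IsProbabilityMeasure μ]

/-- A concentration bound for `U` controls the event that a step of size `|V|` from `U` reaches
`z`, for `V` independent of `U` and weighted by a function of `V`. -/
lemma integral_mul_nearInd_le {U V : Ω → ℝ} (hU : Measurable U) (hV : Measurable V)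
    (hUV : IndepFun U V μ) {c : ℝ}
    (hconc : ∀ a b, a ≤ b → μ.real {ω | U ω ∈ Set.Icc a b} ≤ (b - a) + c)
    (z : ℝ) {g : ℝ → ℝ} (hg : Measurable g) (hg0 : ∀ x, 0 ≤ g x)
    (hgi : Integrable (fun ω => g (V ω)) μ) (hgi1 : Integrable (fun ω => g (V ω) * |V ω|) μ) :
    ∫ ω, g (V ω) * nearInd z (U ω) (V ω) ∂μ
      ≤ 2 * ∫ ω, g (V ω) * |V ω| ∂μ + c * ∫ ω, g (V ω) ∂μ := by
  have hmap := (indepFun_iff_map_prod_eq_prod_map_map hV.aemeasurable hU.aemeasurable).1 hUV.symm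
  set F : ℝ × ℝ → ℝ := fun p => g p.1 * nearInd z p.2 p.1 with hF
  have hFm : Measurable F := (hg.comp measurable_fst).mul
    ((measurable_nearInd z).comp measurable_swap)
  have : IsProbabilityMeasure (μ.map U) := Measure.isProbabilityMeasure_map hU.aemeasurable
  have : IsProbabilityMeasure (μ.map V) := Measure.isProbabilityMeasure_map hV.aemeasurable
  have hFi0 : Integrable (fun ω => F (V ω, U ω)) μ :=
    hgi.mono' (hFm.comp (hV.prodMk hU)).aestronglyMeasurable (ae_of_all _ fun ω => by
      simp only [hF]
      rw [Real.norm_eq_abs, abs_mul, abs_of_nonneg (hg0 _), abs_of_nonneg (nearInd_nonneg _ _ _)]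
      exact mul_le_of_le_one_right (hg0 _) (nearInd_le_one _ _ _))
  have hFi : Integrable F ((μ.map V).prod (μ.map U)) := by
    rw [← hmap, integrable_map_measure hFm.aestronglyMeasurable (hV.prodMk hU).aemeasurable]
    exact hFi0
  have e1 : ∫ ω, g (V ω) * nearInd z (U ω) (V ω) ∂μ
      = ∫ x, ∫ w, F (x, w) ∂(μ.map U) ∂(μ.map V) := by
    rw [← integral_prod _ hFi, ← hmap,
      integral_map (hV.prodMk hU).aemeasurable hFm.aestronglyMeasurable]
  have e2 : ∀ x, ∫ w, F (x, w) ∂(μ.map U) ≤ 2 * (g x * |x|) + c * g x := by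
    intro x
    have h1 : ∀ w, F (x, w) = g x * (Set.Icc (z - |x|) (z + |x|)).indicator 1 w := by
      intro w
      simp only [hF, nearInd, Set.indicator, Set.mem_Icc, abs_le, Pi.one_apply]
      congr 2
      rw [eq_iff_iff]
      constructor <;> rintro ⟨h1, h2⟩ <;> constructor <;> linarith
    simp only [h1]
    rw [integral_const_mul, integral_indicator_one measurableSet_Icc, map_measureReal_apply hU
      measurableSet_Icc]
    have := hconc (z - |x|) (z + |x|) (by linarith [abs_nonneg x])
    have h2 : μ.real (U ⁻¹' Set.Icc (z - |x|) (z + |x|)) ≤ 2 * |x| + c :=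
      this.trans (by linarith)
    nlinarith [mul_le_mul_of_nonneg_left h2 (hg0 x)]
  rw [e1]
  have hgi' : Integrable g (μ.map V) :=
    (integrable_map_measure hg.aestronglyMeasurable hV.aemeasurable).2 hgi
  have hgm1 : Measurable fun x => g x * |x| := by fun_prop
  have hgi1' : Integrable (fun x => g x * |x|) (μ.map V) :=
    (integrable_map_measure hgm1.aestronglyMeasurable hV.aemeasurable).2 hgi1
  refine (integral_mono hFi.integral_prod_left
    ((hgi1'.const_mul 2).add (hgi'.const_mul c)) e2).trans_eq ?_
  simp only [Pi.add_apply]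
  rw [integral_add (hgi1'.const_mul 2) (hgi'.const_mul c), integral_const_mul, integral_const_mul,
    integral_map hV.aemeasurable hgm1.aestronglyMeasurable,
    integral_map hV.aemeasurable hg.aestronglyMeasurable]

variable {ι : Type*} [Fintype ι] [DecidableEq ι] {X : ι → Ω → ℝ}

/-- The contribution of one summand to Stein's identity `E f'(W) ≈ E W f(W)`. -/
lemma abs_stein_term_le (hX : ∀ i, Measurable (X i)) (hind : iIndepFun X μ)
    (h3 : ∀ i, Integrable (fun ω => |X i ω| ^ 3) μ) (h0 : ∀ i, ∫ ω, X i ω ∂μ = 0)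
    (hv : ∑ i, ∫ ω, X i ω ^ 2 ∂μ = 1) {γ : ℝ} (hγ : 0 < γ) (hγ8 : γ ≤ 1 / 8)
    (hs3 : ∑ i, ∫ ω, |X i ω| ^ 3 ∂μ ≤ γ) (z : ℝ) (i : ι) :
    |∫ ω, X i ω * steinSol z (∑ j, X j ω) ∂μ
        - (∫ ω, X i ω ^ 2 ∂μ) * ∫ ω, steinDeriv z (∑ j, X j ω) ∂μ|
      ≤ 12 * ∫ ω, |X i ω| ^ 3 ∂μ + 8 * γ * ∫ ω, X i ω ^ 2 ∂μ := by
  set s := Finset.univ.erase i with hs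
  set V := X i with hV
  set U : Ω → ℝ := fun ω => ∑ j ∈ s, X j ω with hU
  have hVm : Measurable V := hX i
  have hUm : Measurable U := by fun_prop
  have hW : ∀ ω, ∑ j, X j ω = U ω + V ω := fun ω =>
    (Finset.sum_erase_add _ (fun j => X j ω) (Finset.mem_univ i)).symm
  simp only [hW]
  have hUV : IndepFun U V μ := indepFun_sum_left hX hind (Finset.notMem_erase _ _)
  set v := ∫ ω, V ω ^ 2 ∂μ with hv'
  set τ := ∫ ω, |V ω| ^ 3 ∂μ with hτ
  have hv0 : 0 ≤ v := integral_sq_nonneg V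
  have hτ0 : ∀ j, 0 ≤ ∫ ω, |X j ω| ^ 3 ∂μ := fun j =>
    integral_nonneg fun ω => pow_nonneg (abs_nonneg _) 3
  have hV1 : Integrable V μ := integrable_of_cube hVm (h3 i)
  have hV2 : Integrable (fun ω => V ω ^ 2) μ := integrable_sq_of_cube hVm (h3 i)
  have hV3 : Integrable (fun ω => |V ω| ^ 3) μ := h3 i
  have hsv : ∑ j ∈ s, ∫ ω, X j ω ^ 2 ∂μ + v = 1 := by
    rw [← hv]; exact Finset.sum_erase_add _ _ (Finset.mem_univ i)
  have hsτ : ∑ j ∈ s, ∫ ω, |X j ω| ^ 3 ∂μ + τ ≤ γ := by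
    refine le_trans (le_of_eq ?_) hs3
    exact Finset.sum_erase_add _ (fun j => ∫ ω, |X j ω| ^ 3 ∂μ) (Finset.mem_univ i)
  have hs0 : 0 ≤ ∑ j ∈ s, ∫ ω, |X j ω| ^ 3 ∂μ := Finset.sum_nonneg fun j _ => hτ0 j
  -- no single summand carries more than a quarter of the variance
  have hv4 : v ≤ 1 / 4 := by
    have h1 := sqrt_cube_le hVm hV3
    have h2 : √v ^ 3 ≤ (1 / 2) ^ 3 := by
      refine h1.trans ?_
      norm_num; linarith
    have h4 : √v ≤ 1 / 2 := le_of_pow_le_pow_left₀ (by norm_num) (by norm_num) h2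
    calc v = √v ^ 2 := (Real.sq_sqrt hv0).symm
      _ ≤ (1 / 2) ^ 2 := pow_le_pow_left₀ (Real.sqrt_nonneg _) h4 2
      _ = 1 / 4 := by norm_num
  have hconc : ∀ a b, a ≤ b → μ.real {ω | U ω ∈ Set.Icc a b} ≤ (b - a) + 4 * γ := fun a b hab =>
    concentration hX hind h3 h0 s hγ (by linarith [hτ0 i]) (by linarith) (by linarith) hab
  have hU2 : Integrable (fun ω => U ω ^ 2) μ := integrable_sum_sq hX h3 s
  have hU1 : Integrable U μ := integrable_finsetSum _ fun j _ => integrable_of_cube (hX j) (h3 j)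
  have hEU : ∫ ω, |U ω| ∂μ ≤ 1 := by
    refine (integral_abs_le_sqrt hUm hU2).trans ?_
    rw [hU, integral_sum_sq hX hind h3 h0 s]
    exact Real.sqrt_le_one.2 (by linarith)
  have hUi : Integrable (fun ω => |U ω| + 1) μ := hU1.abs.add (integrable_const 1)
  have hEU1 : ∫ ω, (|U ω| + 1) ∂μ ≤ 2 := by
    rw [integral_add hU1.abs (integrable_const 1), integral_const, probReal_univ, one_smul]
    linarith
  -- products of a function of `U` and one of `V`
  have hprod : ∀ g : ℝ → ℝ, Measurable g → (∀ x, 0 ≤ g x) → Integrable (fun ω => g (V ω)) μ →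
      Integrable (fun ω => (|U ω| + 1) * g (V ω)) μ ∧
      ∫ ω, (|U ω| + 1) * g (V ω) ∂μ ≤ 2 * ∫ ω, g (V ω) ∂μ := by
    intro g hg hg0 hgi
    have hi : IndepFun (fun ω => |U ω| + 1) (fun ω => g (V ω)) μ :=
      hUV.comp (φ := fun u => |u| + 1) (by fun_prop) hg
    refine ⟨hi.integrable_mul hUi hgi, ?_⟩
    rw [hi.integral_fun_mul_eq_mul_integral (by fun_prop) (hg.comp hVm).aestronglyMeasurable]
    exact mul_le_mul_of_nonneg_right hEU1 (integral_nonneg fun ω => hg0 _)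
  have hnm : Measurable fun ω => nearInd z (U ω) (V ω) :=
    (measurable_nearInd z).comp (hUm.prodMk hVm)
  have hni : ∀ g : ℝ → ℝ, Measurable g → (∀ x, 0 ≤ g x) → Integrable (fun ω => g (V ω)) μ →
      Integrable (fun ω => g (V ω) * nearInd z (U ω) (V ω)) μ := by
    intro g hg hg0 hgi
    refine hgi.mul_bdd (c := 1) hnm.aestronglyMeasurable (ae_of_all _ fun ω => ?_)
    rw [Real.norm_eq_abs, abs_of_nonneg (nearInd_nonneg _ _ _)]
    exact nearInd_le_one _ _ _
  have hfm := (continuous_steinSol z).measurable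
  have hDm := measurable_steinDeriv z
  have hf_int : ∀ T : Ω → ℝ, Measurable T → Integrable (fun ω => V ω * steinSol z (T ω)) μ :=
    fun T hT => hV1.mul_bdd (c := 2) (hfm.comp hT).aestronglyMeasurable
      (ae_of_all _ fun ω => abs_steinSol_le z _)
  have hD_int : ∀ T : Ω → ℝ, Measurable T → Integrable (fun ω => steinDeriv z (T ω)) μ :=
    fun T hT => (integrable_const (2 : ℝ)).mono' (hDm.comp hT).aestronglyMeasurable
      (ae_of_all _ fun ω => abs_steinDeriv_le z _)
  have hVD_int : Integrable (fun ω => V ω ^ 2 * steinDeriv z (U ω)) μ :=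
    hV2.mul_bdd (c := 2) (hDm.comp hUm).aestronglyMeasurable
      (ae_of_all _ fun ω => abs_steinDeriv_le z _)
  have hVf0 : ∫ ω, V ω * steinSol z (U ω) ∂μ = 0 := by
    have hi : IndepFun V (fun ω => steinSol z (U ω)) μ := hUV.symm.comp measurable_id hfm
    rw [hi.integral_fun_mul_eq_mul_integral hVm.aestronglyMeasurable
      (hfm.comp hUm).aestronglyMeasurable, hV, h0 i, zero_mul]
  have hVD : ∫ ω, V ω ^ 2 * steinDeriv z (U ω) ∂μ = v * ∫ ω, steinDeriv z (U ω) ∂μ := by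
    have hi : IndepFun (fun ω => V ω ^ 2) (fun ω => steinDeriv z (U ω)) μ :=
      hUV.symm.comp (φ := fun x => x ^ 2) (by fun_prop) hDm
    exact hi.integral_fun_mul_eq_mul_integral (by fun_prop) (hDm.comp hUm).aestronglyMeasurable
  -- first-order expansion of `f` around `U`
  have first : |∫ ω, V ω * steinSol z (U ω + V ω) ∂μ - v * ∫ ω, steinDeriv z (U ω) ∂μ|
      ≤ 6 * τ + 4 * γ * v := by
    have hdiff : Integrable
        (fun ω => V ω * steinSol z (U ω + V ω) - V ω * steinSol z (U ω)) μ :=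
      (hf_int _ (hUm.add hVm)).sub (hf_int _ hUm)
    have e : ∫ ω, V ω * steinSol z (U ω + V ω) ∂μ - v * ∫ ω, steinDeriv z (U ω) ∂μ
        = ∫ ω, V ω * (steinSol z (U ω + V ω) - steinSol z (U ω)
            - V ω * steinDeriv z (U ω)) ∂μ := by
      rw [← hVD, ← sub_zero (∫ ω, V ω * steinSol z (U ω + V ω) ∂μ), ← hVf0,
        ← integral_sub (hf_int (fun ω => U ω + V ω) (hUm.add hVm)) (hf_int _ hUm),
        ← integral_sub hdiff hVD_int]
      refine integral_congr_ae (ae_of_all _ fun ω => ?_)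
      simp only; ring
    obtain ⟨i1, b1⟩ := hprod (fun x => |x| ^ 3) (by fun_prop) (fun x => by positivity) hV3
    have i2 := hni (fun x => x ^ 2) (by fun_prop) (fun x => by positivity) hV2
    have hV3' : (fun ω => V ω ^ 2 * |V ω|) = fun ω => |V ω| ^ 3 := by
      ext ω; rw [← sq_abs]; ring
    have b2 := integral_mul_nearInd_le hUm hVm hUV hconc z (g := fun x => x ^ 2) (by fun_prop)
      (fun x => sq_nonneg x) hV2 (by rw [hV3']; exact hV3)
    rw [hV3'] at b2
    rw [e, ← Real.norm_eq_abs]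
    refine (norm_integral_le_of_norm_le ((i1.const_mul 2).add i2)
      (ae_of_all _ fun ω => ?_)).trans ?_
    · have h1 := abs_steinSol_taylor_le z (U ω) (V ω)
      rw [Real.norm_eq_abs, abs_mul]
      refine (mul_le_mul_of_nonneg_left h1 (abs_nonneg _)).trans (le_of_eq ?_)
      simp only [Pi.add_apply, ← sq_abs (V ω)]; ring
    · simp only [Pi.add_apply]
      rw [integral_add (i1.const_mul 2) i2, integral_const_mul]
      linarith
  -- moving the derivative from `U` to `U + V`
  have second : |∫ ω, steinDeriv z (U ω + V ω) ∂μ - ∫ ω, steinDeriv z (U ω) ∂μ|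
      ≤ 6 * ∫ ω, |V ω| ∂μ + 4 * γ := by
    obtain ⟨i1, b1⟩ := hprod (fun x => |x|) (by fun_prop) (fun x => abs_nonneg x) hV1.abs
    have i2 := hni (fun _ => 1) (by fun_prop) (fun x => by positivity) (integrable_const 1)
    have b2 := integral_mul_nearInd_le hUm hVm hUV hconc z (g := fun _ => 1) (by fun_prop)
      (fun x => zero_le_one) (integrable_const 1) (by simpa using hV1.abs)
    simp only [one_mul, integral_const, probReal_univ, one_smul, mul_one] at b2 i2
    rw [← integral_sub (hD_int (fun ω => U ω + V ω) (hUm.add hVm)) (hD_int _ hUm),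
      ← Real.norm_eq_abs]
    refine (norm_integral_le_of_norm_le ((i1.const_mul 2).add i2)
      (ae_of_all _ fun ω => ?_)).trans ?_
    · refine (abs_steinDeriv_sub_le z (U ω) (V ω)).trans (le_of_eq ?_)
      simp only [Pi.add_apply]; ring
    · simp only [Pi.add_apply]
      rw [integral_add (i1.const_mul 2) i2, integral_const_mul]
      linarith
  have third : v * ∫ ω, |V ω| ∂μ ≤ τ := integral_sq_mul_integral_abs_le hVm hV3
  have second' : |v * ∫ ω, steinDeriv z (U ω) ∂μ - v * ∫ ω, steinDeriv z (U ω + V ω) ∂μ|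
      ≤ 6 * τ + 4 * γ * v := by
    rw [← mul_sub, abs_mul, abs_of_nonneg hv0, abs_sub_comm]
    calc v * _ ≤ v * (6 * ∫ ω, |V ω| ∂μ + 4 * γ) := mul_le_mul_of_nonneg_left second hv0
      _ ≤ _ := by linarith
  refine (abs_sub_le _ (v * ∫ ω, steinDeriv z (U ω) ∂μ) _).trans ?_
  linarith

lemma abs_measure_sub_Phi_le_one (A : Set Ω) (z : ℝ) : |μ.real A - Phi z| ≤ 1 := by
  have := Phi_pos z
  have := Phi_lt_one z
  have := measureReal_nonneg (μ := μ) (s := A)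
  have := measureReal_le_one (μ := μ) (s := A)
  rw [abs_le]; constructor <;> linarith

/-- The Berry–Esseen inequality for sums of unit variance: `E f'(W) - E W f(W)` is the error of
the normal approximation, and it is small summand by summand. -/
lemma berryEsseen_normalized (hX : ∀ i, Measurable (X i)) (hind : iIndepFun X μ)
    (h3 : ∀ i, Integrable (fun ω => |X i ω| ^ 3) μ) (h0 : ∀ i, ∫ ω, X i ω ∂μ = 0)
    (hv : ∑ i, ∫ ω, X i ω ^ 2 ∂μ = 1) (z : ℝ) :
    |μ.real {ω | ∑ i, X i ω ≤ z} - Phi z| ≤ 20 * ∑ i, ∫ ω, |X i ω| ^ 3 ∂μ := by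
  set γ := ∑ i, ∫ ω, |X i ω| ^ 3 ∂μ with hγdef
  rcases le_or_gt γ (1 / 8) with hγ8 | hγ8
  swap
  · exact (abs_measure_sub_Phi_le_one _ z).trans (by linarith)
  have hγ : 0 < γ := by
    obtain ⟨i, -, hi⟩ : ∃ i ∈ Finset.univ, 0 < ∫ ω, X i ω ^ 2 ∂μ :=
      Finset.exists_lt_of_sum_lt (f := fun _ => (0 : ℝ)) (by simp [hv])
    have h1 : 0 < ∫ ω, |X i ω| ^ 3 ∂μ :=
      (pow_pos (Real.sqrt_pos.2 hi) 3).trans_le (sqrt_cube_le (hX i) (h3 i))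
    exact h1.trans_le (Finset.single_le_sum
      (f := fun i => ∫ ω, |X i ω| ^ 3 ∂μ)
      (fun j _ => integral_nonneg fun ω => pow_nonneg (abs_nonneg _) 3) (Finset.mem_univ i))
  set W : Ω → ℝ := fun ω => ∑ i, X i ω with hW
  have hWm : Measurable W := by fun_prop
  have hf_int : ∀ i, Integrable (fun ω => X i ω * steinSol z (W ω)) μ :=
    fun i => (integrable_of_cube (hX i) (h3 i)).mul_bdd (c := 2)
      ((continuous_steinSol z).measurable.comp hWm).aestronglyMeasurable
      (ae_of_all _ fun ω => abs_steinSol_le z _)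
  have hD_int : Integrable (fun ω => steinDeriv z (W ω)) μ :=
    (integrable_const (2 : ℝ)).mono'
      ((measurable_steinDeriv z).comp hWm).aestronglyMeasurable
      (ae_of_all _ fun ω => abs_steinDeriv_le z _)
  have hAm : MeasurableSet {ω | W ω ≤ z} := measurableSet_le hWm measurable_const
  have e1 : μ.real {ω | W ω ≤ z} - Phi z
      = ∫ ω, steinDeriv z (W ω) ∂μ - ∫ ω, W ω * steinSol z (W ω) ∂μ := by
    have hWf : Integrable (fun ω => W ω * steinSol z (W ω)) μ := by
      simp only [hW, Finset.sum_mul]; exact integrable_finsetSum _ fun i _ => hf_int i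
    rw [← integral_sub hD_int hWf, ← integral_indicator_one hAm]
    have h1 : Integrable ({ω | W ω ≤ z}.indicator (1 : Ω → ℝ)) μ :=
      (integrable_const 1).indicator hAm
    have h2 : Phi z = ∫ _ω, Phi z ∂μ := by simp
    rw [h2, ← integral_sub h1 (integrable_const _)]
    refine integral_congr_ae (ae_of_all _ fun ω => ?_)
    simp [steinDeriv, Set.indicator]
  have e2 : ∫ ω, W ω * steinSol z (W ω) ∂μ = ∑ i, ∫ ω, X i ω * steinSol z (W ω) ∂μ := by
    simp only [hW, Finset.sum_mul]
    exact integral_finsetSum _ fun i _ => hf_int i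
  have e3 : ∫ ω, steinDeriv z (W ω) ∂μ
      = ∑ i, (∫ ω, X i ω ^ 2 ∂μ) * ∫ ω, steinDeriv z (W ω) ∂μ := by
    rw [← Finset.sum_mul, hv, one_mul]
  rw [e1, e2, e3, ← Finset.sum_sub_distrib]
  refine (Finset.abs_sum_le_sum_abs _ _).trans ?_
  have h4 : ∀ i ∈ Finset.univ, |(∫ ω, X i ω ^ 2 ∂μ) * ∫ ω, steinDeriv z (W ω) ∂μ
      - ∫ ω, X i ω * steinSol z (W ω) ∂μ|
      ≤ 12 * ∫ ω, |X i ω| ^ 3 ∂μ + 8 * γ * ∫ ω, X i ω ^ 2 ∂μ := fun i _ => by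
    rw [abs_sub_comm]
    exact abs_stein_term_le hX hind h3 h0 hv hγ hγ8 le_rfl z i
  refine (Finset.sum_le_sum h4).trans (le_of_eq ?_)
  rw [Finset.sum_add_distrib, ← Finset.mul_sum, ← Finset.mul_sum, hv]
  linarith

end BerryEsseen

lemma integral_sq_pos {Ω : Type*} [MeasurableSpace Ω] {μ : Measure Ω} [IsProbabilityMeasure μ]
    {X : Ω → ℝ} (hX : Measurable X) (h3 : Integrable (fun ω => |X ω| ^ 3) μ)
    (hnd : NonDegenerate μ X) : 0 < ∫ ω, X ω ^ 2 ∂μ := by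
  refine lt_of_le_of_ne (integral_sq_nonneg X) fun h => hnd ⟨0, ?_⟩
  have := (integral_eq_zero_iff_of_nonneg (fun ω => sq_nonneg (X ω))
    (integrable_sq_of_cube hX h3)).1 h.symm
  filter_upwards [this] with ω hω
  simpa using hω

lemma isBerryEsseenConstant_twenty : IsBerryEsseenConstant 20 := by
  intro Ω _ μ _ n ξ hn hξ hind hnd h3 h0 x
  have : Nonempty (Fin n) := ⟨⟨0, hn⟩⟩
  set σ := sdSum μ ξ with hσ
  have hσ2 : σ ^ 2 = ∑ i, ∫ ω, ξ i ω ^ 2 ∂μ :=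
    Real.sq_sqrt (Finset.sum_nonneg fun i _ => integral_sq_nonneg _)
  have hσ0 : 0 < σ := Real.sqrt_pos.2 (Finset.sum_pos
    (fun i _ => integral_sq_pos (hξ i) (h3 i) (hnd i)) Finset.univ_nonempty)
  have h := berryEsseen_normalized (X := fun i ω => ξ i ω / σ) (μ := μ)
    (fun i => (hξ i).div_const σ) (hind.comp (fun _ x => x / σ) (fun _ => by fun_prop))
    (fun i => by simp only [abs_div, div_pow]; exact (h3 i).div_const _)
    (fun i => by rw [integral_div, h0 i, zero_div]) ?_ x
  · simp only [abs_div, div_pow, integral_div, ← Finset.sum_div, abs_of_pos hσ0,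
      div_le_iff₀ hσ0] at h
    exact h
  · simp only [div_pow, integral_div, ← Finset.sum_div]
    rw [← hσ2, div_self (pow_pos hσ0 2).ne']

/-- The infimum defining `C₃` is attained. -/
lemma isBerryEsseenConstant_C3 : IsBerryEsseenConstant C3 := by
  intro Ω _ μ _ n ξ hn hξ hind hnd h3 h0 x
  have : Nonempty (Fin n) := ⟨⟨0, hn⟩⟩
  have hpos := fun i => integral_sq_pos (hξ i) (h3 i) (hnd i)
  have hσ0 : 0 < sdSum μ ξ := Real.sqrt_pos.2 (Finset.sum_pos
    (fun i _ => hpos i) Finset.univ_nonempty)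
  have hL : 0 < (∑ i, ∫ ω, |ξ i ω| ^ 3 ∂μ) / sdSum μ ξ ^ 3 :=
    div_pos (Finset.sum_pos (fun i _ => (pow_pos (Real.sqrt_pos.2 (hpos i)) 3).trans_le
      (sqrt_cube_le (hξ i) (h3 i))) Finset.univ_nonempty) (pow_pos hσ0 3)
  rw [← div_le_iff₀ hL]
  refine le_csInf ⟨20, isBerryEsseenConstant_twenty⟩ fun C hC => ?_
  rw [div_le_iff₀ hL]
  exact hC Ω μ n ξ hn hξ hind hnd h3 h0 x

/-! ### Laplace transforms of positive parts under normal approximation -/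

/-- The function `v ↦ exp (-y v) 1_{v > 0}`. -/
def expPos (y v : ℝ) : ℝ := (Set.Ioi (0 : ℝ)).indicator (fun v => Real.exp (-(y * v))) v

lemma expPos_nonneg (y v : ℝ) : 0 ≤ expPos y v :=
  Set.indicator_nonneg (fun _ _ => (Real.exp_pos _).le) _

lemma expPos_le_one {y : ℝ} (hy : 0 ≤ y) (v : ℝ) : expPos y v ≤ 1 := by
  refine Set.indicator_le' (fun v hv => ?_) (fun _ _ => zero_le_one) v
  exact Real.exp_le_one_iff.2 (neg_nonpos.2 (mul_nonneg hy (le_of_lt hv)))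

lemma measurable_expPos (y : ℝ) : Measurable (expPos y) :=
  Measurable.indicator (by fun_prop) measurableSet_Ioi

lemma integrable_expPos {ν : Measure ℝ} [IsProbabilityMeasure ν] {y : ℝ} (hy : 0 ≤ y) :
    Integrable (expPos y) ν :=
  (integrable_const (1 : ℝ)).mono' (measurable_expPos y).aestronglyMeasurable
    (ae_of_all _ fun v => by
      rw [Real.norm_eq_abs, abs_of_nonneg (expPos_nonneg y v)]; exact expPos_le_one hy v)

lemma integral_expPos_gaussian (y : ℝ) :
    ∫ v, expPos y v ∂(gaussianReal 0 1) = mills y / √(2 * Real.pi) := by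
  rw [integral_gaussianReal_eq_integral_smul one_ne_zero, mills, div_eq_inv_mul,
    ← integral_const_mul, ← integral_indicator measurableSet_Ioi]
  refine integral_congr_ae (ae_of_all _ fun v => ?_)
  simp only [expPos, Set.indicator]
  split_ifs
  · rw [gaussianPDFReal_std, smul_eq_mul, mul_assoc, ← Real.exp_add]
    congr 2; ring
  · simp

lemma setOf_le_expPos {y u : ℝ} (hy : 0 < y) (hu : 0 < u) :
    {v | u ≤ expPos y v} = Set.Iic (-Real.log u / y) \ Set.Iic 0 := by
  ext v
  simp only [Set.mem_ofPred_eq, expPos, Set.indicator, Set.mem_Ioi, Set.mem_sdiff, Set.mem_Iic,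
    not_le]
  split_ifs with hv
  · rw [← Real.log_le_iff_le_exp hu, le_div_iff₀ hy]
    constructor
    · intro h; exact ⟨by linarith, hv⟩
    · rintro ⟨h, -⟩; linarith
  · constructor
    · intro h; linarith
    · rintro ⟨-, h⟩; exact absurd h hv

lemma setOf_le_expPos_zero {u : ℝ} (hu : 0 < u) (hu1 : u ≤ 1) :
    {v | u ≤ expPos 0 v} = (Set.Iic 0)ᶜ := by
  ext v
  simp only [Set.mem_ofPred_eq, expPos, Set.indicator, Set.mem_Ioi, Set.mem_compl_iff, Set.mem_Iic,
    not_le, zero_mul, neg_zero, Real.exp_zero]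
  split_ifs with hv
  · simp [hu1, hv]
  · simp [hu, hv]

/-- If the distribution function of `ν` is within `Δ` of `Φ`, then the integral of
`exp (-y v) 1_{v > 0}` against `ν` exceeds the Gaussian one by at most `2 Δ`: the superlevel sets
of that function are intervals. -/
lemma integral_expPos_le {ν : Measure ℝ} [IsProbabilityMeasure ν] {Δ : ℝ}
    (hΔ : ∀ z, |ν.real (Set.Iic z) - Phi z| ≤ Δ) {y : ℝ} (hy : 0 ≤ y) :
    ∫ v, expPos y v ∂ν ≤ mills y / √(2 * Real.pi) + 2 * Δ := by
  have hΔ0 : 0 ≤ Δ := (abs_nonneg _).trans (hΔ 0)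
  have layer : ∀ ρ : Measure ℝ, IsProbabilityMeasure ρ →
      ∫ v, expPos y v ∂ρ = ∫ u in Set.Ioc (0 : ℝ) 1, ρ.real {v | u ≤ expPos y v} := by
    intro ρ _
    rw [(integrable_expPos hy).integral_eq_integral_meas_le (ae_of_all _ (expPos_nonneg y))]
    refine setIntegral_eq_of_subset_of_forall_sdiff_eq_zero measurableSet_Ioi
      Set.Ioc_subset_Ioi_self fun u hu => ?_
    have hu1 : 1 < u := by
      by_contra h; exact hu.2 ⟨hu.1, not_lt.1 h⟩
    have : {v | u ≤ expPos y v} = ∅ := by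
      ext v
      simpa using (expPos_le_one hy v).trans_lt hu1
    rw [this, measureReal_empty]
  have hint : ∀ ρ : Measure ℝ, IsProbabilityMeasure ρ →
      IntegrableOn (fun u => ρ.real {v | u ≤ expPos y v}) (Set.Ioc (0 : ℝ) 1) := by
    intro ρ _
    have hanti : Antitone fun u => ρ.real {v | u ≤ expPos y v} := fun u u' h =>
      measureReal_mono fun v (hv : u' ≤ _) => h.trans hv
    refine Integrable.mono' (g := fun _ => 1) (integrable_const _)
      hanti.measurable.aestronglyMeasurable (ae_of_all _ fun u => ?_)
    rw [Real.norm_eq_abs, abs_of_nonneg measureReal_nonneg]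
    exact measureReal_le_one
  have key : ∀ u ∈ Set.Ioc (0 : ℝ) 1, ν.real {v | u ≤ expPos y v}
      ≤ (gaussianReal 0 1).real {v | u ≤ expPos y v} + 2 * Δ := by
    rintro u ⟨hu0, hu1⟩
    have h0 := abs_le.1 (hΔ 0)
    rw [Phi_eq_measure] at h0
    rcases hy.eq_or_lt with rfl | hy
    · rw [setOf_le_expPos_zero hu0 hu1, measureReal_compl measurableSet_Iic,
        measureReal_compl measurableSet_Iic]
      simp only [probReal_univ]
      linarith [h0.1]
    · have hc := abs_le.1 (hΔ (-Real.log u / y))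
      rw [Phi_eq_measure] at hc
      have hsub : Set.Iic (0 : ℝ) ⊆ Set.Iic (-Real.log u / y) :=
        Set.Iic_subset_Iic.2 (div_nonneg (neg_nonneg.2 (Real.log_nonpos hu0.le hu1)) hy.le)
      rw [setOf_le_expPos hy hu0, measureReal_sdiff hsub measurableSet_Iic,
        measureReal_sdiff hsub measurableSet_Iic]
      linarith [h0.1, hc.2]
  rw [← integral_expPos_gaussian, layer ν inferInstance, layer (gaussianReal 0 1) inferInstance]
  have h1 : IntegrableOn (fun _ : ℝ => 2 * Δ) (Set.Ioc (0 : ℝ) 1) := integrable_const _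
  refine (setIntegral_mono_on (hint ν inferInstance) ((hint _ inferInstance).add h1)
    measurableSet_Ioc key).trans_eq ?_
  simp only [Pi.add_apply]
  rw [integral_add (hint _ inferInstance) h1]
  simp

/-! ### Exponential tilting of one variable -/

lemma exp_le_quadratic_of_nonpos {z : ℝ} (hz : z ≤ 0) : Real.exp z ≤ 1 + z + z ^ 2 / 2 := by
  have h1 := Real.quadratic_le_exp_of_nonneg (neg_nonneg.2 hz)
  have h2 : Real.exp z * Real.exp (-z) = 1 := by rw [← Real.exp_add, add_neg_cancel, Real.exp_zero]
  have h3 : 0 < Real.exp z := Real.exp_pos z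
  have h4 : 0 ≤ 1 + z + z ^ 2 / 2 := by nlinarith [sq_nonneg (z + 1)]
  nlinarith [mul_le_mul_of_nonneg_left h1 (mul_nonneg h4 h3.le), pow_nonneg (sq_nonneg z) 2,
    mul_le_mul_of_nonneg_left h1 h3.le, mul_nonneg h3.le (pow_nonneg (sq_nonneg z) 2)]

lemma exp_sub_one_le {z s : ℝ} (hz : 0 ≤ z) (hzs : z ≤ s) (hs : s ≤ 1) :
    Real.exp z - 1 ≤ z * (1 + s / 2 + s ^ 2 / 4) := by
  have h := Real.exp_bound' hz (hzs.trans hs) (n := 3) (by norm_num)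
  norm_num [Finset.sum_range_succ, Nat.factorial] at h
  have h2 : z ^ 2 ≤ s ^ 2 := pow_le_pow_left₀ hz hzs 2
  nlinarith [mul_le_mul_of_nonneg_left hzs hz, mul_le_mul_of_nonneg_left h2 hz,
    mul_nonneg hz (sq_nonneg z)]

/-- Monotonicity of `(e^u - 1 - u) / u²`, cleared of denominators. -/
lemma exp_sub_affine_mul_sq_le {u v : ℝ} (huv : u ≤ v) (hv : 0 ≤ v) :
    (Real.exp u - 1 - u) * v ^ 2 ≤ (Real.exp v - 1 - v) * u ^ 2 := by
  rcases le_or_gt u 0 with hu | hu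
  · have h1 := exp_le_quadratic_of_nonpos hu
    have h2 := Real.quadratic_le_exp_of_nonneg hv
    nlinarith [mul_le_mul_of_nonneg_right h1 (sq_nonneg v),
      mul_le_mul_of_nonneg_right h2 (sq_nonneg u)]
  · have hv0 : 0 < v := hu.trans_le huv
    have hmono : MonotoneOn (fun u : ℝ => (Real.exp u - 1 - u) / u ^ 2) (Set.Ioi 0) := by
      have hd : ∀ x ∈ Set.Ioi (0 : ℝ), HasDerivAt (fun u : ℝ => (Real.exp u - 1 - u) / u ^ 2)
          (((Real.exp x - 1) * x ^ 2 - (Real.exp x - 1 - x) * (2 * x)) / (x ^ 2) ^ 2) x := by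
        intro x hx
        have hx : (0 : ℝ) < x := hx
        have := (((Real.hasDerivAt_exp x).sub_const 1).fun_sub (hasDerivAt_id' x)).fun_div
          (hasDerivAt_pow 2 x) (by positivity)
        exact this.congr_deriv (by norm_num)
      refine monotoneOn_of_deriv_nonneg (convex_Ioi 0)
        (fun x hx => (hd x hx).continuousAt.continuousWithinAt) ?_ ?_
      · intro x hx
        rw [interior_Ioi] at hx
        exact (hd x hx).differentiableAt.differentiableWithinAt
      · intro x hx
        rw [interior_Ioi] at hx
        rw [(hd x hx).deriv]
        have hx : (0 : ℝ) < x := hx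
        -- the numerator of the derivative is `x` times this expression
        have h : 0 ≤ (x - 2) * Real.exp x + x + 2 := by
          have hm : MonotoneOn (fun x : ℝ => (x - 2) * Real.exp x + x + 2) (Set.Ici 0) := by
            have hd' : ∀ x : ℝ, HasDerivAt (fun x : ℝ => (x - 2) * Real.exp x + x + 2)
                ((x - 1) * Real.exp x + 1) x := by
              intro x
              have := ((((hasDerivAt_id' x).sub_const 2).fun_mul (Real.hasDerivAt_exp x)).fun_add
                (hasDerivAt_id' x)).add_const 2
              exact this.congr_deriv (by ring)
            refine monotoneOn_of_deriv_nonneg (convex_Ici 0)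
              (fun x _ => (hd' x).continuousAt.continuousWithinAt)
              (fun x _ => (hd' x).differentiableAt.differentiableWithinAt) fun x _ => ?_
            rw [(hd' x).deriv]
            have h1 := Real.add_one_le_exp (-x)
            have h2 : Real.exp x * Real.exp (-x) = 1 := by
              rw [← Real.exp_add, add_neg_cancel, Real.exp_zero]
            nlinarith [Real.exp_pos x]
          have := hm (Set.mem_Ici.2 le_rfl) (Set.mem_Ici.2 hx.le) hx.le
          simp at this
          linarith
        refine div_nonneg ?_ (by positivity)
        nlinarith [mul_nonneg hx.le h]
    have := hmono hu hv0 huv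
    simp only at this
    rwa [div_le_div_iff₀ (by positivity) (by positivity)] at this

section Tilt

variable {ν : Measure ℝ} {σ B l : ℝ}

/-- The standing assumptions on the law `ν` of one summand: it is centered with variance
`σ² > 0`, carried by `(-∞, σ]`, and its third absolute moment is at most `B σ²`. -/
structure Summand (ν : Measure ℝ) (σ B : ℝ) : Prop where
  prob : IsProbabilityMeasure ν
  pos : 0 < σ
  cube : Integrable (fun x : ℝ => |x| ^ 3) ν
  mean : ∫ x, x ∂ν = 0
  var : ∫ x, x ^ 2 ∂ν = σ ^ 2
  le : ∀ᵐ x ∂ν, x ≤ σ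
  third : ∫ x, |x| ^ 3 ∂ν ≤ B * σ ^ 2

namespace Summand

lemma integrable_id (h : Summand ν σ B) : Integrable (fun x : ℝ => x) ν :=
  have := h.prob
  integrable_of_cube measurable_id h.cube

lemma integrable_sq (h : Summand ν σ B) : Integrable (fun x : ℝ => x ^ 2) ν :=
  have := h.prob
  integrable_sq_of_cube measurable_id h.cube

lemma le_const (h : Summand ν σ B) : σ ≤ B := by
  have := h.prob
  have h1 := (sqrt_cube_le (X := fun x : ℝ => x) measurable_id h.cube).trans h.third
  rw [h.var, Real.sqrt_sq h.pos.le] at h1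
  have := pow_pos h.pos 2
  nlinarith

lemma ae_exp_le (h : Summand ν σ B) (hl : 0 ≤ l) :
    ∀ᵐ x ∂ν, Real.exp (l * x) ≤ Real.exp (l * σ) := by
  filter_upwards [h.le] with x hx
  exact Real.exp_le_exp.2 (mul_le_mul_of_nonneg_left hx hl)

lemma integrable_mul_exp (h : Summand ν σ B) (hl : 0 ≤ l) {g : ℝ → ℝ} (hg : Integrable g ν) :
    Integrable (fun x => g x * Real.exp (l * x)) ν := by
  refine hg.mul_bdd (c := Real.exp (l * σ)) (by fun_prop) ?_
  filter_upwards [h.ae_exp_le hl] with x hx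
  rwa [Real.norm_eq_abs, Real.abs_exp]

lemma integrable_exp (h : Summand ν σ B) (hl : 0 ≤ l) :
    Integrable (fun x => Real.exp (l * x)) ν := by
  have := h.prob
  simpa using h.integrable_mul_exp hl (integrable_const 1)

lemma one_le_mgf (h : Summand ν σ B) (hl : 0 ≤ l) : 1 ≤ ∫ x, Real.exp (l * x) ∂ν := by
  have := h.prob
  have h1 : ∫ x, (l * x + 1) ∂ν ≤ ∫ x, Real.exp (l * x) ∂ν :=
    integral_mono ((h.integrable_id.const_mul l).add (integrable_const 1)) (h.integrable_exp hl)
      fun x => Real.add_one_le_exp _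
  rw [integral_add (h.integrable_id.const_mul l) (integrable_const 1), integral_const_mul,
    h.mean] at h1
  simpa using h1

/-- Among the laws of the class, the symmetric two-point law has the largest exponential moments:
on `(-∞, σ]`, `exp (l x)` lies below the quadratic polynomial that is tangent to it at `-σ` and
meets it at `σ`. -/
lemma mgf_le (h : Summand ν σ B) (hl : 0 ≤ l) :
    ∫ x, Real.exp (l * x) ∂ν ≤ Real.exp ((l * σ) ^ 2 / 2) := by
  have := h.prob
  refine le_trans ?_ (Real.cosh_le_exp_half_sq (l * σ))
  rcases hl.eq_or_lt with rfl | hl0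
  · simp
  set a := l * σ with ha
  have ha0 : 0 < a := mul_pos hl0 h.pos
  set c := (Real.exp (2 * a) - 1 - 2 * a) / (2 * a) ^ 2 with hc
  have hpt : ∀ᵐ x ∂ν, Real.exp (l * x)
      ≤ Real.exp (-a) * ((1 + a + c * a ^ 2) + (l + 2 * c * a * l) * x + c * l ^ 2 * x ^ 2) := by
    filter_upwards [h.le] with x hx
    have h1 := exp_sub_affine_mul_sq_le (u := l * x + a) (v := 2 * a)
      (by nlinarith) (by positivity)
    have h2 : Real.exp (l * x + a) - 1 - (l * x + a) ≤ c * (l * x + a) ^ 2 := by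
      rw [hc, div_mul_eq_mul_div, le_div_iff₀ (by positivity)]; exact h1
    have h3 : Real.exp (l * x) = Real.exp (-a) * Real.exp (l * x + a) := by
      rw [← Real.exp_add]; congr 1; ring
    rw [h3]
    refine mul_le_mul_of_nonneg_left ?_ (Real.exp_pos _).le
    nlinarith
  have i1 : Integrable (fun x : ℝ => (1 + a + c * a ^ 2) + (l + 2 * c * a * l) * x) ν :=
    (integrable_const _).add (h.integrable_id.const_mul _)
  have i2 := h.integrable_sq.const_mul (c * l ^ 2)
  have h4 := integral_mono_ae (h.integrable_exp hl) ((i1.add i2).const_mul (Real.exp (-a))) hpt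
  simp only [Pi.add_apply] at h4
  rw [integral_const_mul, integral_add i1 i2,
    integral_add (integrable_const _) (h.integrable_id.const_mul _), integral_const_mul,
    integral_const_mul, h.mean, h.var, integral_const, probReal_univ, one_smul] at h4
  refine h4.trans (le_of_eq ?_)
  have h5 : c * l ^ 2 * σ ^ 2 = c * a ^ 2 := by rw [ha]; ring
  have h6 : 4 * (c * a ^ 2) = Real.exp (2 * a) - 1 - 2 * a := by rw [hc]; field_simp; ring
  have h7 : Real.exp (-a) * Real.exp (2 * a) = Real.exp a := by
    rw [← Real.exp_add]; congr 1; ring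
  rw [h5, Real.cosh_eq]
  linear_combination Real.exp (-a) * h6 / 2 + h7 / 2

lemma integral_tilted_eq (g : ℝ → ℝ) :
    ∫ x, g x ∂(ν.tilted fun x => l * x)
      = (∫ x, g x * Real.exp (l * x) ∂ν) / ∫ x, Real.exp (l * x) ∂ν := by
  rw [integral_tilted, ← integral_div]
  refine integral_congr_ae (ae_of_all _ fun x => ?_)
  simp only [smul_eq_mul]; ring

lemma integrable_tilted (h : Summand ν σ B) (hl : 0 ≤ l) {g : ℝ → ℝ} (hg : Integrable g ν) :
    Integrable g (ν.tilted fun x => l * x) := by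
  rw [integrable_tilted_iff (h.integrable_exp hl)]
  refine (h.integrable_mul_exp hl hg).congr (ae_of_all _ fun x => ?_)
  simp only [smul_eq_mul]; ring

lemma mul_exp_lower (l x : ℝ) (hl : 0 ≤ l) :
    x + l * x ^ 2 - l ^ 2 / 2 * |x| ^ 3 ≤ x * Real.exp (l * x) := by
  rcases le_total 0 x with hx | hx
  · have h1 := Real.add_one_le_exp (l * x)
    rw [abs_of_nonneg hx]
    nlinarith [mul_le_mul_of_nonneg_left h1 hx, mul_nonneg (sq_nonneg l) (pow_nonneg hx 3)]
  · have h1 := exp_le_quadratic_of_nonpos (mul_nonpos_of_nonneg_of_nonpos hl hx)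
    rw [abs_of_nonpos hx]
    nlinarith [mul_le_mul_of_nonpos_left h1 hx]

lemma mul_exp_upper {l x s : ℝ} (hl : 0 ≤ l) (hs0 : 0 ≤ s) (hxs : l * x ≤ s) (hs : s ≤ 1) :
    x * Real.exp (l * x) ≤ x + l * (1 + s / 2 + s ^ 2 / 4) * x ^ 2 := by
  rcases le_total 0 x with hx | hx
  · have h1 := exp_sub_one_le (mul_nonneg hl hx) hxs hs
    nlinarith [mul_le_mul_of_nonneg_left h1 hx]
  · have h1 := Real.add_one_le_exp (l * x)
    have h2 : 0 ≤ l * x ^ 2 * (s / 2 + s ^ 2 / 4) := by positivity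
    nlinarith [mul_le_mul_of_nonpos_left h1 hx]

lemma integral_mul_exp_lower (h : Summand ν σ B) (hl : 0 ≤ l) :
    l * σ ^ 2 * (1 - l * B / 2) ≤ ∫ x, x * Real.exp (l * x) ∂ν := by
  have i1 : Integrable (fun x : ℝ => x + l * x ^ 2) ν :=
    h.integrable_id.add (h.integrable_sq.const_mul l)
  have i2 := h.cube.const_mul (l ^ 2 / 2)
  have h1 := integral_mono (i1.sub i2) (h.integrable_mul_exp hl h.integrable_id)
    fun x => mul_exp_lower l x hl
  simp only [Pi.sub_apply] at h1
  rw [integral_sub i1 i2, integral_add h.integrable_id (h.integrable_sq.const_mul l),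
    integral_const_mul, integral_const_mul, h.mean, h.var] at h1
  have := mul_le_mul_of_nonneg_left h.third (by positivity : 0 ≤ l ^ 2 / 2)
  linarith

lemma tilted_mean_lower (h : Summand ν σ B) (hl : 0 ≤ l) (hs : l * B ≤ 1) :
    l * σ ^ 2 * (1 - l * B) ≤ ∫ x, x ∂(ν.tilted fun x => l * x) := by
  rw [integral_tilted_eq]
  have hm1 := h.one_le_mgf hl
  have hm2 := h.mgf_le hl
  set m := ∫ x, Real.exp (l * x) ∂ν
  have hm0 : 0 < m := by linarith
  rw [le_div_iff₀ hm0]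
  refine le_trans ?_ (h.integral_mul_exp_lower hl)
  set s := l * B with hs'
  have hσB := h.le_const
  have hls0 : 0 ≤ l * σ := mul_nonneg hl h.pos.le
  have hls : l * σ ≤ s := mul_le_mul_of_nonneg_left hσB hl
  have hs0 : 0 ≤ s := hls0.trans hls
  -- `m (1 - s) ≤ e^{s²/2} (1 - s) ≤ 1 - s / 2`
  have h1 : m ≤ Real.exp (s ^ 2 / 2) := hm2.trans (Real.exp_le_exp.2 (by
    have := pow_le_pow_left₀ hls0 hls 2; linarith))
  have h2 : 1 - s ^ 2 / 2 ≤ Real.exp (-(s ^ 2 / 2)) := by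
    linarith [Real.add_one_le_exp (-(s ^ 2 / 2))]
  have h3 : Real.exp (s ^ 2 / 2) * Real.exp (-(s ^ 2 / 2)) = 1 := by
    rw [← Real.exp_add, add_neg_cancel, Real.exp_zero]
  have h4 : m * (1 - s ^ 2 / 2) ≤ 1 :=
    (mul_le_mul h1 h2 (by nlinarith) (Real.exp_pos _).le).trans_eq h3
  have h5 : 1 - s ≤ (1 - s / 2) * (1 - s ^ 2 / 2) := by
    nlinarith [mul_nonneg hs0 (sub_nonneg.2 hs), mul_nonneg hs0 (sq_nonneg s)]
  have h6 : m * (1 - s) ≤ 1 - s / 2 := by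
    nlinarith [mul_le_mul_of_nonneg_left h5 hm0.le,
      mul_le_mul_of_nonneg_left h4 (by linarith : 0 ≤ 1 - s / 2)]
  have := mul_le_mul_of_nonneg_left h6 (mul_nonneg hl (sq_nonneg σ))
  linarith

lemma tilted_mean_upper (h : Summand ν σ B) (hl : 0 ≤ l) (hs : l * B ≤ 1) :
    ∫ x, x ∂(ν.tilted fun x => l * x)
      ≤ l * σ ^ 2 * (1 + l * B / 2 + (l * B) ^ 2 / 4) := by
  rw [integral_tilted_eq]
  have hm1 := h.one_le_mgf hl
  have hσB := h.le_const
  have hB : 0 ≤ B := h.pos.le.trans hσB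
  have i2 := h.integrable_sq.const_mul (l * (1 + l * B / 2 + (l * B) ^ 2 / 4))
  have h1 : ∫ x, x * Real.exp (l * x) ∂ν ≤ l * σ ^ 2 * (1 + l * B / 2 + (l * B) ^ 2 / 4) := by
    refine (integral_mono_ae (h.integrable_mul_exp hl h.integrable_id)
      (h.integrable_id.add i2) ?_).trans_eq ?_
    · filter_upwards [h.le] with x hx
      exact mul_exp_upper hl (mul_nonneg hl hB)
        (mul_le_mul_of_nonneg_left (hx.trans hσB) hl) hs
    · simp only [Pi.add_apply]
      rw [integral_add h.integrable_id i2, integral_const_mul, h.mean, h.var]; ring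
  refine div_le_of_le_mul₀ (by linarith) (by positivity) (h1.trans ?_)
  exact le_mul_of_one_le_right (by positivity) hm1

/-- Lower bound for the variance of the tilted law, before normalization. It is obtained by
symmetrization: the left-hand side is half the integral of `(x - y)² exp (l (x + y))` against
`ν ⊗ ν`, where the exponential is at least `1 + l (x + y)`. -/
lemma symmetrized_variance_lower (h : Summand ν σ B) (hl : 0 ≤ l) :
    σ ^ 2 * (1 - l * B) ≤
      (∫ x, x ^ 2 * Real.exp (l * x) ∂ν) * (∫ x, Real.exp (l * x) ∂ν)
        - (∫ x, x * Real.exp (l * x) ∂ν) ^ 2 := by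
  have := h.prob
  have i0 := h.integrable_exp hl
  have i1 := h.integrable_mul_exp hl h.integrable_id
  have i2 := h.integrable_mul_exp hl h.integrable_sq
  have j1 := h.integrable_id
  have j2 := h.integrable_sq
  have j3 : Integrable (fun x : ℝ => x ^ 3) ν :=
    h.cube.mono' (by fun_prop) (ae_of_all _ fun x => by simp)
  set m0 := ∫ x, Real.exp (l * x) ∂ν
  set m1 := ∫ x, x * Real.exp (l * x) ∂ν
  set m2 := ∫ x, x ^ 2 * Real.exp (l * x) ∂ν
  set κ := ∫ x, x ^ 3 ∂ν with hκ
  have hκB : -(B * σ ^ 2) ≤ κ := by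
    have h1 : |κ| ≤ ∫ x, |x| ^ 3 ∂ν := by
      refine (abs_integral_le_integral_abs).trans (le_of_eq ?_)
      simp only [abs_pow]
    linarith [neg_abs_le κ, h.third]
  have inner : ∀ y : ℝ, (σ ^ 2 + y ^ 2) * (1 + l * y) + l * (κ - 2 * y * σ ^ 2)
      ≤ (m2 + y ^ 2 * m0) * Real.exp (l * y) - 2 * m1 * (y * Real.exp (l * y)) := by
    intro y
    have k1 : Integrable (fun x : ℝ => l * x ^ 3 + (1 - l * y) * x ^ 2) ν :=
      (j3.const_mul l).add (j2.const_mul _)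
    have k2 : Integrable (fun x : ℝ => l * x ^ 3 + (1 - l * y) * x ^ 2
        + (-2 * y - l * y ^ 2) * x) ν := k1.add (j1.const_mul _)
    have k3 : Integrable (fun x : ℝ => l * x ^ 3 + (1 - l * y) * x ^ 2
        + (-2 * y - l * y ^ 2) * x + y ^ 2 * (1 + l * y)) ν := k2.add (integrable_const _)
    have q1 : Integrable (fun x : ℝ => Real.exp (l * y) * (x ^ 2 * Real.exp (l * x))
        + (-2 * y * Real.exp (l * y)) * (x * Real.exp (l * x))) ν :=
      (i2.const_mul _).add (i1.const_mul _)
    have q2 : Integrable (fun x : ℝ => Real.exp (l * y) * (x ^ 2 * Real.exp (l * x))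
        + (-2 * y * Real.exp (l * y)) * (x * Real.exp (l * x))
        + (y ^ 2 * Real.exp (l * y)) * Real.exp (l * x)) ν := q1.add (i0.const_mul _)
    have h1 := integral_mono k3 q2 fun x => by
      have h2 := mul_le_mul_of_nonneg_left (Real.add_one_le_exp (l * x + l * y))
        (sq_nonneg (x - y))
      rw [Real.exp_add] at h2
      simp only
      linarith
    rw [integral_add k2 (integrable_const _), integral_add k1 (j1.const_mul _),
      integral_add (j3.const_mul l) (j2.const_mul _), integral_add q1 (i0.const_mul _),
      integral_add (i2.const_mul _) (i1.const_mul _),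
      integral_const_mul _ (fun x : ℝ => x), h.mean] at h1
    simp only [integral_const_mul, integral_const, probReal_univ, one_smul, h.var] at h1
    linarith
  have k1 : Integrable (fun y : ℝ => l * y ^ 3 + y ^ 2) ν := (j3.const_mul l).add j2
  have k2 : Integrable (fun y : ℝ => l * y ^ 3 + y ^ 2 + (l * σ ^ 2 - 2 * l * σ ^ 2) * y) ν :=
    k1.add (j1.const_mul _)
  have k3 : Integrable (fun y : ℝ => l * y ^ 3 + y ^ 2 + (l * σ ^ 2 - 2 * l * σ ^ 2) * y
      + (σ ^ 2 + l * κ)) ν := k2.add (integrable_const _)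
  have q1 : Integrable (fun y : ℝ => m2 * Real.exp (l * y)
      + m0 * (y ^ 2 * Real.exp (l * y))) ν := (i0.const_mul _).add (i2.const_mul _)
  have q2 : Integrable (fun y : ℝ => m2 * Real.exp (l * y)
      + m0 * (y ^ 2 * Real.exp (l * y)) + (-2 * m1) * (y * Real.exp (l * y))) ν :=
    q1.add (i1.const_mul _)
  have h1 := integral_mono k3 q2 fun y => by
    have := inner y
    simp only
    linarith
  rw [integral_add k2 (integrable_const _), integral_add k1 (j1.const_mul _),
    integral_add (j3.const_mul l) j2, integral_add q1 (i1.const_mul _),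
    integral_add (i0.const_mul _) (i2.const_mul _),
    integral_const_mul _ (fun x : ℝ => x), h.mean] at h1
  simp only [integral_const_mul, integral_const, probReal_univ, one_smul, h.var] at h1
  have h2 := mul_le_mul_of_nonneg_left hκB hl
  change l * κ + σ ^ 2 + (l * σ ^ 2 - 2 * l * σ ^ 2) * 0 + (σ ^ 2 + l * κ)
    ≤ m2 * m0 + m0 * m2 + -2 * m1 * m1 at h1
  linarith

lemma isProbabilityMeasure_tilted (h : Summand ν σ B) (hl : 0 ≤ l) :
    IsProbabilityMeasure (ν.tilted fun x => l * x) :=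
  have := h.prob
  MeasureTheory.isProbabilityMeasure_tilted (h.integrable_exp hl)

lemma tilted_variance_lower (h : Summand ν σ B) (hl : 0 ≤ l) (hs : l * B ≤ 1) :
    σ ^ 2 * ((1 - l * B) * Real.exp (-(l * B) ^ 2)) ≤
      ∫ x, (x - ∫ y, y ∂(ν.tilted fun x => l * x)) ^ 2 ∂(ν.tilted fun x => l * x) := by
  have := h.isProbabilityMeasure_tilted hl
  set ρ := ν.tilted fun x => l * x with hρ
  set c := ∫ y, y ∂ρ with hc
  have r1 : Integrable (fun x : ℝ => x) ρ := h.integrable_tilted hl h.integrable_id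
  have r2 : Integrable (fun x : ℝ => x ^ 2) ρ := h.integrable_tilted hl h.integrable_sq
  have e : ∫ x, (x - c) ^ 2 ∂ρ = ∫ x, x ^ 2 ∂ρ - c ^ 2 := by
    have k1 : Integrable (fun x : ℝ => x ^ 2 + (-2 * c) * x) ρ := r2.add (r1.const_mul _)
    have : (fun x : ℝ => (x - c) ^ 2) = fun x => (x ^ 2 + (-2 * c) * x) + c ^ 2 := by
      ext x; ring
    rw [this, integral_add k1 (integrable_const _), integral_add r2 (r1.const_mul _),
      integral_const_mul, ← hc]
    simp only [integral_const, probReal_univ, one_smul]; ring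
  have hsym := h.symmetrized_variance_lower hl
  have hm1 := h.one_le_mgf hl
  have hm2 := h.mgf_le hl
  rw [e, hc, hρ, integral_tilted_eq, integral_tilted_eq]
  set m0 := ∫ x, Real.exp (l * x) ∂ν
  set m1 := ∫ x, x * Real.exp (l * x) ∂ν
  set m2 := ∫ x, x ^ 2 * Real.exp (l * x) ∂ν
  have hm0 : 0 < m0 := by linarith
  have e2 : m2 / m0 - (m1 / m0) ^ 2 = (m2 * m0 - m1 ^ 2) / m0 ^ 2 := by field_simp
  rw [e2, le_div_iff₀ (by positivity)]
  refine le_trans ?_ hsym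
  have hls0 : 0 ≤ l * σ := mul_nonneg hl h.pos.le
  have hls : l * σ ≤ l * B := mul_le_mul_of_nonneg_left h.le_const hl
  have h1 : m0 ^ 2 ≤ Real.exp ((l * B) ^ 2) := by
    refine (pow_le_pow_left₀ hm0.le hm2 2).trans ?_
    rw [← Real.exp_nat_mul]
    refine Real.exp_le_exp.2 ?_
    have := pow_le_pow_left₀ hls0 hls 2
    push_cast; linarith
  have h2 : Real.exp (-(l * B) ^ 2) * m0 ^ 2 ≤ 1 := by
    refine (mul_le_mul_of_nonneg_left h1 (Real.exp_pos _).le).trans_eq ?_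
    rw [← Real.exp_add, neg_add_cancel, Real.exp_zero]
  have := mul_le_mul_of_nonneg_left h2
    (mul_nonneg (sq_nonneg σ) (sub_nonneg.2 hs))
  linarith

lemma abs_sub_cube_le (x c : ℝ) : |x - c| ^ 3 ≤ 4 * (|x| ^ 3 + |c| ^ 3) := by
  have h1 : |x - c| ≤ |x| + |c| := by
    simpa using abs_sub x c
  refine (pow_le_pow_left₀ (abs_nonneg _) h1 3).trans ?_
  have hx := abs_nonneg x
  have hc := abs_nonneg c
  nlinarith [mul_nonneg (add_nonneg hx hc) (sq_nonneg (|x| - |c|))]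

lemma tilted_third_upper (h : Summand ν σ B) (hl : 0 ≤ l) :
    Integrable (fun x => |x - ∫ y, y ∂(ν.tilted fun x => l * x)| ^ 3)
      (ν.tilted fun x => l * x) ∧
    ∫ x, |x - ∫ y, y ∂(ν.tilted fun x => l * x)| ^ 3 ∂(ν.tilted fun x => l * x)
      ≤ 8 * (Real.exp (l * B) * (B * σ ^ 2)) := by
  have := h.isProbabilityMeasure_tilted hl
  have hm1 := h.one_le_mgf hl
  have hmom : ∫ x, |x| ^ 3 ∂(ν.tilted fun x => l * x) ≤ Real.exp (l * B) * (B * σ ^ 2) := by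
    rw [integral_tilted_eq]
    have h0 : 0 ≤ ∫ x, |x| ^ 3 ∂ν := integral_nonneg fun x => by positivity
    refine div_le_of_le_mul₀ (by linarith)
      (mul_nonneg (Real.exp_pos _).le (h0.trans h.third)) ?_
    have h1 : ∫ x, |x| ^ 3 * Real.exp (l * x) ∂ν ≤ ∫ x, |x| ^ 3 * Real.exp (l * B) ∂ν := by
      refine integral_mono_ae (h.integrable_mul_exp hl h.cube) (h.cube.mul_const _) ?_
      filter_upwards [h.ae_exp_le hl] with x hx
      refine mul_le_mul_of_nonneg_left (hx.trans (Real.exp_le_exp.2 ?_)) (by positivity)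
      exact mul_le_mul_of_nonneg_left h.le_const hl
    rw [integral_mul_const] at h1
    have h2 := mul_le_mul_of_nonneg_right h.third (Real.exp_pos (l * B)).le
    have h3 : 0 ≤ Real.exp (l * B) * (B * σ ^ 2) :=
      mul_nonneg (Real.exp_pos _).le (h0.trans h.third)
    nlinarith
  set ρ := ν.tilted fun x => l * x with hρ
  set c := ∫ y, y ∂ρ with hc
  have r1 : Integrable (fun x : ℝ => x) ρ := h.integrable_tilted hl h.integrable_id
  have r2 : Integrable (fun x : ℝ => x ^ 2) ρ := h.integrable_tilted hl h.integrable_sq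
  have r3 : Integrable (fun x : ℝ => |x| ^ 3) ρ := h.integrable_tilted hl h.cube
  have hc3 : |c| ^ 3 ≤ ∫ x, |x| ^ 3 ∂ρ := by
    have h1 : |c| ≤ ∫ x, |x| ∂ρ := abs_integral_le_integral_abs
    have h2 := integral_abs_le_sqrt (X := fun x : ℝ => x) measurable_id r2
    exact (pow_le_pow_left₀ (abs_nonneg c) (h1.trans h2) 3).trans
      (sqrt_cube_le (X := fun x : ℝ => x) measurable_id r3)
  have k : Integrable (fun x : ℝ => 4 * (|x| ^ 3 + |c| ^ 3)) ρ :=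
    (r3.add (integrable_const _)).const_mul 4
  have hi : Integrable (fun x => |x - c| ^ 3) ρ :=
    k.mono' (by fun_prop) (ae_of_all _ fun x => by
      rw [Real.norm_eq_abs, abs_of_nonneg (by positivity)]; exact abs_sub_cube_le x c)
  refine ⟨hi, (integral_mono hi k fun x => abs_sub_cube_le x c).trans ?_⟩
  rw [integral_const_mul, integral_add r3 (integrable_const _)]
  simp only [integral_const, probReal_univ, one_smul]
  linarith

/-- The mean of the tilted law depends continuously on the tilt, up to and including `l = 0`. -/
lemma continuousOn_tilted_mean (h : Summand ν σ B) (b : ℝ) :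
    ContinuousOn (fun l => ∫ x, x ∂(ν.tilted fun x => l * x)) (Set.Icc 0 b) := by
  have := h.prob
  simp only [integral_tilted_eq]
  have hbd : ∀ l ∈ Set.Icc (0 : ℝ) b, ∀ᵐ x ∂ν, Real.exp (l * x) ≤ Real.exp (b * σ) := by
    rintro l ⟨h0, h1⟩
    filter_upwards [h.ae_exp_le h0] with x hx
    exact hx.trans (Real.exp_le_exp.2 (mul_le_mul_of_nonneg_right h1 h.pos.le))
  refine ContinuousOn.div ?_ ?_ fun l hl => (zero_lt_one.trans_le (h.one_le_mgf hl.1)).ne'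
  · refine continuousOn_of_dominated (bound := fun x => |x| * Real.exp (b * σ))
      (fun l _ => by fun_prop) (fun l hl => ?_) (h.integrable_id.abs.mul_const _)
      (ae_of_all _ fun x => by fun_prop)
    filter_upwards [hbd l hl] with x hx
    rw [norm_mul, Real.norm_eq_abs, Real.norm_eq_abs, Real.abs_exp]
    exact mul_le_mul_of_nonneg_left hx (abs_nonneg x)
  · refine continuousOn_of_dominated (bound := fun x => Real.exp (b * σ))
      (fun l _ => by fun_prop) (fun l hl => ?_) (integrable_const _)
      (ae_of_all _ fun x => by fun_prop)
    filter_upwards [hbd l hl] with x hx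
    rwa [Real.norm_eq_abs, Real.abs_exp]

/-- Convexity of the cumulant generating function: it lies above its tangent at `l`. -/
lemma mgf_tangent (h : Summand ν σ B) (hl : 0 ≤ l) {k : ℝ} (hk : 0 ≤ k) :
    (∫ x, Real.exp (l * x) ∂ν) * Real.exp ((k - l) * ∫ x, x ∂(ν.tilted fun x => l * x))
      ≤ ∫ x, Real.exp (k * x) ∂ν := by
  rw [integral_tilted_eq]
  have hm1 := h.one_le_mgf hl
  have i0 := h.integrable_exp hl
  have i1 := h.integrable_mul_exp hl h.integrable_id
  set m0 := ∫ x, Real.exp (l * x) ∂ν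
  set m1 := ∫ x, x * Real.exp (l * x) ∂ν
  have hm0 : 0 < m0 := by linarith
  set c := m1 / m0 with hc
  have k1 : Integrable (fun x => (k - l) * (x * Real.exp (l * x))
      + (1 - (k - l) * c) * Real.exp (l * x)) ν := (i1.const_mul _).add (i0.const_mul _)
  have h1 := integral_mono (k1.const_mul (Real.exp ((k - l) * c))) (h.integrable_exp hk)
    fun x => by
      have h2 := Real.add_one_le_exp ((k - l) * (x - c))
      have h3 : Real.exp (k * x)
          = Real.exp ((k - l) * c) * (Real.exp ((k - l) * (x - c)) * Real.exp (l * x)) := by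
        rw [← Real.exp_add, ← Real.exp_add]; congr 1; ring
      simp only
      rw [h3]
      refine mul_le_mul_of_nonneg_left ?_ (Real.exp_pos _).le
      have := mul_le_mul_of_nonneg_right h2 (Real.exp_pos (l * x)).le
      linarith
  rw [integral_const_mul, integral_add (i1.const_mul _) (i0.const_mul _), integral_const_mul,
    integral_const_mul] at h1
  refine le_trans (le_of_eq ?_) h1
  change _ = _ * ((k - l) * m1 + (1 - (k - l) * c) * m0)
  have : m1 = c * m0 := by rw [hc]; field_simp
  rw [this]; ring

end Summand
end Tilt

/-! ### Elementary estimates for the explicit constant -/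

lemma tParam_spec {u : ℝ} (hu : 0 ≤ u) (hu4 : u < 1 / 4) :
    0 ≤ tParam u ∧ tParam u < 1 / 2 ∧ tParam u * (1 - tParam u) = u := by
  set r := √(1 - 4 * u) with hr
  have hr2 : r ^ 2 = 1 - 4 * u := Real.sq_sqrt (by linarith)
  have hr0 : 0 < r := Real.sqrt_pos.2 (by linarith)
  have ht : tParam u = (1 - r) / 2 := by
    rw [tParam, ← hr, div_eq_div_iff (by positivity) two_ne_zero]
    nlinarith
  rw [ht]
  refine ⟨?_, by linarith, by nlinarith⟩
  nlinarith

lemma one_le_sqrt_one_sub_mul {s : ℝ} (hs0 : 0 ≤ s) (hs : s ≤ 1 / 2) :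
    1 ≤ √(1 - s) * (1 + s / 2 + 7 / 10 * s ^ 2) := by
  have h0 : 0 ≤ 1 - s := by linarith
  have h : (1 / (1 + s / 2 + 7 / 10 * s ^ 2)) ^ 2 ≤ 1 - s := by
    rw [div_pow, div_le_iff₀ (by positivity)]
    have h1 : 0 ≤ s ^ 2 := sq_nonneg s
    have h2 : 0 ≤ s ^ 3 := by positivity
    have : (1 - s) * (1 + s / 2 + 7 / 10 * s ^ 2) ^ 2 - 1
        = s ^ 2 * (13 / 20 - 19 / 20 * s - 21 / 100 * s ^ 2 - 49 / 100 * s ^ 3) := by ring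
    have h5 : 0 ≤ 13 / 20 - 19 / 20 * s - 21 / 100 * s ^ 2 - 49 / 100 * s ^ 3 := by
      have h6 : s ^ 2 ≤ (1 / 2) ^ 2 := pow_le_pow_left₀ hs0 hs 2
      have h7 : s ^ 3 ≤ (1 / 2) ^ 3 := pow_le_pow_left₀ hs0 hs 3
      norm_num at h6 h7
      linarith
    nlinarith [mul_nonneg h1 h5]
  have h2 := Real.le_sqrt_of_sq_le h
  rwa [div_le_iff₀ (by positivity)] at h2

/-- The quotient of the bounds for the mean and for the standard deviation under tilting. -/
lemma mean_bound_le {s : ℝ} (hs0 : 0 ≤ s) (hs : s ≤ 1 / 2) :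
    1 + s / 2 + s ^ 2 / 4
      ≤ √(1 - s) * Real.exp (-s ^ 2 / 2) * (1 + √2 * s * Real.exp (s + s ^ 2)) := by
  have h1 := one_le_sqrt_one_sub_mul hs0 hs
  set r := √(1 - s)
  set E := Real.exp (s ^ 2 / 2) with hE
  set F := Real.exp (-s ^ 2 / 2) with hF
  have hE0 : 0 < E := Real.exp_pos _
  have hF0 : 0 < F := Real.exp_pos _
  have hr0 : 0 ≤ r := Real.sqrt_nonneg _
  have hFE : F * E = 1 := by
    rw [hE, hF, ← Real.exp_add, ← Real.exp_zero]; congr 1; ring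
  have hF1 : 1 - s ^ 2 / 2 ≤ F := by
    have := Real.add_one_le_exp (-s ^ 2 / 2); linarith
  have hw : 7 / 5 ≤ √2 := Real.le_sqrt_of_sq_le (by norm_num)
  have hG : E * (1 + s + s ^ 2 / 2) ≤ Real.exp (s + s ^ 2) := by
    have e : Real.exp (s + s ^ 2) = E * Real.exp (s + s ^ 2 / 2) := by
      rw [hE, ← Real.exp_add]; congr 1; ring
    rw [e]
    refine mul_le_mul_of_nonneg_left ?_ hE0.le
    have := Real.add_one_le_exp (s + s ^ 2 / 2); linarith
  have h2 : 7 / 5 * s * (E * (1 + s + s ^ 2 / 2)) ≤ √2 * s * Real.exp (s + s ^ 2) :=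
    mul_le_mul (mul_le_mul_of_nonneg_right hw hs0) hG (by positivity) (by positivity)
  -- `F (1 + √2 s e^{s + s²}) ≥ 1 - s²/2 + (7/5) s (1 + s + s²/2)`
  have h3 : (1 + s / 2 + s ^ 2 / 4) * (1 + s / 2 + 7 / 10 * s ^ 2)
      ≤ F * (1 + √2 * s * Real.exp (s + s ^ 2)) := by
    have h4 : F * (1 + 7 / 5 * s * (E * (1 + s + s ^ 2 / 2)))
        ≤ F * (1 + √2 * s * Real.exp (s + s ^ 2)) :=
      mul_le_mul_of_nonneg_left (by linarith) hF0.le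
    refine le_trans ?_ h4
    have e : F * (1 + 7 / 5 * s * (E * (1 + s + s ^ 2 / 2)))
        = F + 7 / 5 * s * (1 + s + s ^ 2 / 2) * (F * E) := by ring
    rw [e, hFE, mul_one]
    refine le_trans ?_ (add_le_add_left hF1 _)
    have h6 : s ^ 2 ≤ 1 / 2 * s := by nlinarith
    have h7 : s ^ 3 ≤ 1 / 4 * s := by nlinarith
    have h8 : s ^ 4 ≤ 1 / 8 * s := by nlinarith [mul_nonneg hs0 (sq_nonneg s)]
    nlinarith
  have h5 : 0 ≤ 1 + s / 2 + s ^ 2 / 4 := by positivity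
  calc 1 + s / 2 + s ^ 2 / 4 = (1 + s / 2 + s ^ 2 / 4) * 1 := (mul_one _).symm
    _ ≤ (1 + s / 2 + s ^ 2 / 4) * (r * (1 + s / 2 + 7 / 10 * s ^ 2)) :=
      mul_le_mul_of_nonneg_left h1 h5
    _ = r * ((1 + s / 2 + s ^ 2 / 4) * (1 + s / 2 + 7 / 10 * s ^ 2)) := by ring
    _ ≤ r * (F * (1 + √2 * s * Real.exp (s + s ^ 2))) := mul_le_mul_of_nonneg_left h3 hr0
    _ = _ := by ring

/-- Since `y ↦ y * mills y` is increasing and `mills` is decreasing, replacing `x` by `y`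
multiplies the Mills ratio by at most `max 1 (x / y)`. -/
lemma mills_le_of_le_mul {x y R : ℝ} (hy : 0 ≤ y) (hR : 1 ≤ R) (hxy : x ≤ y * R) :
    mills y ≤ mills x * R := by
  have hM := mills_pos x
  rcases le_or_gt x y with h | h
  · exact (mills_antitone h).trans (le_mul_of_one_le_right hM.le hR)
  · rcases hy.eq_or_lt with rfl | hy
    · linarith
    · have h1 := mul_mills_mono hy h.le
      have h2 := mul_le_mul_of_nonneg_right hxy hM.le
      refine le_of_mul_le_mul_left ?_ hy
      linarith

/-! ### The change of measure for independent summands -/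

section Pi

variable {n : ℕ} {ν : Fin n → Measure ℝ} {σ : Fin n → ℝ} {B l : ℝ}

lemma integral_exp_sum [∀ i, IsProbabilityMeasure (ν i)] (l : ℝ) :
    ∫ ω, Real.exp (l * ∑ i, ω i) ∂(Measure.pi ν) = ∏ i, ∫ x, Real.exp (l * x) ∂(ν i) := by
  simp only [Finset.mul_sum, Real.exp_sum]
  exact integral_fintype_prod_eq_prod (fun _ x => Real.exp (l * x))

/-- Tilting a product measure by the sum of the coordinates tilts each factor. -/
lemma pi_tilted (h : ∀ i, Summand (ν i) (σ i) B) (hl : 0 ≤ l) :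
    Measure.pi (fun i => (ν i).tilted fun x => l * x)
      = (Measure.pi ν).tilted fun ω => l * ∑ i, ω i := by
  have := fun i => (h i).prob
  have := fun i => (h i).isProbabilityMeasure_tilted hl
  refine Measure.pi_eq fun s hs => ?_
  rw [tilted_apply_eq_ofReal_integral' _ (MeasurableSet.univ_pi hs), integral_exp_sum]
  simp only [tilted_apply_eq_ofReal_integral' _ (hs _)]
  rw [← ENNReal.ofReal_prod_of_nonneg fun i _ => integral_nonneg fun x =>
    div_nonneg (Real.exp_pos _).le (integral_nonneg fun _ => (Real.exp_pos _).le)]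
  congr 1
  simp only [← integral_indicator (hs _)]
  rw [← integral_fintype_prod_eq_prod
    (fun i x => (s i).indicator (fun x => Real.exp (l * x) / ∫ x, Real.exp (l * x) ∂(ν i)) x),
    ← integral_indicator (MeasurableSet.univ_pi hs)]
  refine integral_congr_ae (ae_of_all _ fun ω => ?_)
  simp only
  by_cases hω : ω ∈ Set.univ.pi s
  · rw [Set.indicator_of_mem hω, Finset.mul_sum, Real.exp_sum, ← Finset.prod_div_distrib]
    refine Finset.prod_congr rfl fun i _ => ?_
    rw [Set.indicator_of_mem (hω i (Set.mem_univ i))]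
  · rw [Set.indicator_of_notMem hω]
    obtain ⟨i, hi⟩ : ∃ i, ω i ∉ s i := by simpa [Set.mem_pi] using hω
    exact (Finset.prod_eq_zero (Finset.mem_univ i) (Set.indicator_of_notMem hi _)).symm

/-- The tail of the sum, expressed through the tilted product measure. -/
lemma tail_eq_tilted (h : ∀ i, Summand (ν i) (σ i) B) (hl : 0 ≤ l) (c : ℝ) :
    (Measure.pi ν).real {ω | c < ∑ i, ω i}
      = (∏ i, ∫ x, Real.exp (l * x) ∂(ν i)) * Real.exp (-(l * c))
        * ∫ ω, expPos l (∑ i, ω i - c) ∂(Measure.pi fun i => (ν i).tilted fun x => l * x) := by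
  have := fun i => (h i).prob
  have hZ : 0 < ∏ i, ∫ x, Real.exp (l * x) ∂(ν i) :=
    Finset.prod_pos fun i _ => zero_lt_one.trans_le ((h i).one_le_mgf hl)
  have hA : MeasurableSet {ω : Fin n → ℝ | c < ∑ i, ω i} :=
    measurableSet_lt measurable_const (by fun_prop)
  rw [pi_tilted h hl, integral_tilted, integral_exp_sum, ← integral_const_mul,
    ← integral_indicator_one hA]
  refine integral_congr_ae (ae_of_all _ fun ω => ?_)
  simp only [smul_eq_mul, expPos, Set.indicator, Set.mem_Ioi, Set.mem_ofPred_eq, sub_pos,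
    Pi.one_apply]
  split_ifs
  · have e : Real.exp (-(l * c)) * Real.exp (l * ∑ i, ω i)
        * Real.exp (-(l * (∑ i, ω i - c))) = 1 := by
      rw [← Real.exp_add, ← Real.exp_add, ← Real.exp_zero]; congr 1; ring
    field_simp
    linarith
  · simp

/-- The Chernoff factor at the saddle point. If the tilted means add up to `x S`, then `l`
minimizes the convex function `k ↦ ∏ᵢ E exp (k ξᵢ) * exp (-k x S)`, which is at most
`exp (-x² / 2)` at `k = x / S`. -/
lemma prod_mgf_le (h : ∀ i, Summand (ν i) (σ i) B) (hl : 0 ≤ l) {x S : ℝ} (hx : 0 ≤ x)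
    (hS : 0 < S) (hS2 : S ^ 2 = ∑ i, σ i ^ 2)
    (hc : ∑ i, ∫ y, y ∂((ν i).tilted fun y => l * y) = x * S) :
    (∏ i, ∫ y, Real.exp (l * y) ∂(ν i)) * Real.exp (-(l * (x * S))) ≤ Real.exp (-x ^ 2 / 2) := by
  set k := x / S with hk
  have hk0 : 0 ≤ k := div_nonneg hx hS.le
  have h1 : ∏ i, ((∫ y, Real.exp (l * y) ∂(ν i))
      * Real.exp ((k - l) * ∫ y, y ∂((ν i).tilted fun y => l * y)))
      ≤ ∏ i, Real.exp ((k * σ i) ^ 2 / 2) :=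
    Finset.prod_le_prod (fun i _ => mul_nonneg (integral_nonneg fun _ => (Real.exp_pos _).le)
      (Real.exp_pos _).le) fun i _ => ((h i).mgf_tangent hl hk0).trans ((h i).mgf_le hk0)
  rw [Finset.prod_mul_distrib, ← Real.exp_sum, ← Real.exp_sum, ← Finset.mul_sum, hc,
    ← Finset.sum_div] at h1
  simp only [mul_pow, ← Finset.mul_sum, ← hS2] at h1
  have h2 : k ^ 2 * S ^ 2 / 2 = x ^ 2 / 2 := by rw [hk]; field_simp
  have h3 : (k - l) * (x * S) = x ^ 2 + -(l * (x * S)) := by rw [hk]; field_simp; ring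
  rw [h2, h3, Real.exp_add] at h1
  have h4 : Real.exp (-x ^ 2 / 2) = Real.exp (x ^ 2 / 2) * Real.exp (-x ^ 2) := by
    rw [← Real.exp_add]; congr 1; ring
  have h5 : Real.exp (x ^ 2) * Real.exp (-x ^ 2) = 1 := by
    rw [← Real.exp_add, add_neg_cancel, Real.exp_zero]
  rw [h4]
  have := mul_le_mul_of_nonneg_right h1 (Real.exp_pos (-x ^ 2)).le
  refine le_trans (le_of_eq ?_) this
  linear_combination (-(∏ i, ∫ y, Real.exp (l * y) ∂(ν i)) * Real.exp (-(l * (x * S)))) * h5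

/-- The tilt for which the tilted means add up to `x S`: by the intermediate value theorem, since
these means are at least `x S` in total at `l = t / B`. -/
lemma exists_saddle (h : ∀ i, Summand (ν i) (σ i) B) (hB : 0 < B) {t x S : ℝ} (hx : 0 ≤ x)
    (hS : 0 < S) (hS2 : S ^ 2 = ∑ i, σ i ^ 2) (ht0 : 0 ≤ t) (ht1 : t ≤ 1)
    (ht : t * (1 - t) = x * B / S) :
    ∃ l ∈ Set.Icc 0 (t / B), ∑ i, ∫ y, y ∂((ν i).tilted fun y => l * y) = x * S := by
  have hcont : ContinuousOn (fun l => ∑ i, ∫ y, y ∂((ν i).tilted fun y => l * y))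
      (Set.Icc 0 (t / B)) :=
    continuousOn_finsetSum _ fun i _ => (h i).continuousOn_tilted_mean _
  have htB : 0 ≤ t / B := div_nonneg ht0 hB.le
  refine intermediate_value_Icc htB hcont ⟨?_, ?_⟩
  · have : ∀ i, ∫ y, y ∂((ν i).tilted fun y => 0 * y) = 0 := fun i => by
      rw [Summand.integral_tilted_eq]
      simp [(h i).mean]
    simp only [this, Finset.sum_const_zero]
    positivity
  · have h1 : ∀ i ∈ Finset.univ, t / B * σ i ^ 2 * (1 - t / B * B)
        ≤ ∫ y, y ∂((ν i).tilted fun y => t / B * y) := fun i _ =>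
      (h i).tilted_mean_lower htB (by rwa [div_mul_cancel₀ _ hB.ne'])
    refine le_trans (le_of_eq ?_) (Finset.sum_le_sum h1)
    rw [← Finset.sum_mul, ← Finset.mul_sum, ← hS2, div_mul_cancel₀ _ hB.ne']
    have : x = t * (1 - t) * S / B := by rw [ht]; field_simp
    rw [this]; field_simp

end Pi

/-! ### The tail bound -/

section Tail

variable {n : ℕ} {ν : Fin n → Measure ℝ} {σ : Fin n → ℝ} {B l : ℝ}

/-- Normal approximation under the tilted product measure, with `T` the standard deviation of the
tilted sum. The last term is twice the Berry–Esseen error. That `C₃` is nonnegative is read off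
from the same application of the Berry–Esseen inequality. -/
lemma tilted_integral_le (hn : 0 < n) (h : ∀ i, Summand (ν i) (σ i) B) (hl : 0 ≤ l)
    (hs : l * B ≤ 1 / 2) {c S : ℝ} (hS2 : S ^ 2 = ∑ i, σ i ^ 2)
    (hc : ∑ i, ∫ y, y ∂((ν i).tilted fun y => l * y) = c) :
    0 ≤ C3 ∧ ∃ T, S * (√(1 - l * B) * Real.exp (-(l * B) ^ 2 / 2)) ≤ T ∧
      ∫ ω, expPos l (∑ i, ω i - c) ∂(Measure.pi fun i => (ν i).tilted fun x => l * x)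
        ≤ mills (l * T) / √(2 * Real.pi)
          + 2 * (C3 * (8 * (Real.exp (l * B) * (B * S ^ 2)) / T ^ 3)) := by
  have hne : Nonempty (Fin n) := ⟨⟨0, hn⟩⟩
  have hp := fun i => (h i).isProbabilityMeasure_tilted hl
  set s := l * B with hs'
  have hs1 : 0 < 1 - s := by linarith
  set ρ : Fin n → Measure ℝ := fun i => (ν i).tilted fun x => l * x with hρ
  set P := Measure.pi ρ with hP
  set m : Fin n → ℝ := fun i => ∫ y, y ∂(ρ i) with hm
  set X : Fin n → (Fin n → ℝ) → ℝ := fun i ω => ω i - m i with hX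
  have hXm : ∀ i, Measurable (X i) := fun i => by simp only [hX]; fun_prop
  have hind : iIndepFun X P :=
    iIndepFun_pi (X := fun i x => x - m i) fun i => by fun_prop
  have hEX : ∀ i, ∀ g : ℝ → ℝ, Measurable g →
      ∫ ω, g (X i ω) ∂P = ∫ x, g (x - m i) ∂(ρ i) := fun i g hg =>
    integral_comp_eval (μ := ρ) (f := fun x => g (x - m i))
      (hg.comp (measurable_sub_const _)).aestronglyMeasurable
  have hr1 : ∀ i, Integrable (fun x : ℝ => x) (ρ i) := fun i =>
    (h i).integrable_tilted hl (h i).integrable_id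
  have h0 : ∀ i, ∫ ω, X i ω ∂P = 0 := fun i => by
    rw [hEX i (fun x => x) measurable_id, integral_sub (hr1 i) (integrable_const _)]
    simp [hm]
  have h3 : ∀ i, Integrable (fun ω => |X i ω| ^ 3) P := fun i =>
    (measurePreserving_eval ρ i).integrable_comp_of_integrable
      (g := fun x => |x - m i| ^ 3) ((h i).tilted_third_upper hl).1
  have h3le : ∀ i, ∫ ω, |X i ω| ^ 3 ∂P ≤ 8 * (Real.exp s * (B * σ i ^ 2)) := fun i => by
    rw [hEX i (fun x => |x| ^ 3) (by fun_prop)]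
    exact ((h i).tilted_third_upper hl).2
  have hvle : ∀ i, σ i ^ 2 * ((1 - s) * Real.exp (-s ^ 2)) ≤ ∫ ω, X i ω ^ 2 ∂P := fun i => by
    rw [hEX i (fun x => x ^ 2) (by fun_prop)]
    exact (h i).tilted_variance_lower hl (by linarith)
  have hq0 : 0 < (1 - s) * Real.exp (-s ^ 2) := mul_pos hs1 (Real.exp_pos _)
  have hvpos : ∀ i, 0 < ∫ ω, X i ω ^ 2 ∂P := fun i =>
    (mul_pos (pow_pos (h i).pos 2) hq0).trans_le (hvle i)
  have hnd : ∀ i, NonDegenerate P (X i) := by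
    rintro i ⟨a, ha⟩
    have h1 : a = 0 := by
      have := h0 i
      rw [integral_congr_ae ha] at this
      simpa using this
    have h2 : ∫ ω, X i ω ^ 2 ∂P = 0 := by
      rw [integral_congr_ae (g := fun _ => (0 : ℝ)) (by
        filter_upwards [ha] with ω hω; rw [hω, h1]; simp)]
      simp
    exact (hvpos i).ne' h2
  set T := sdSum P X with hT
  have hT2 : T ^ 2 = ∑ i, ∫ ω, X i ω ^ 2 ∂P :=
    Real.sq_sqrt (Finset.sum_nonneg fun i _ => (hvpos i).le)
  have hT0 : 0 < T := Real.sqrt_pos.2 (Finset.sum_pos (fun i _ => hvpos i)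
    Finset.univ_nonempty)
  have hTS : S * (√(1 - s) * Real.exp (-s ^ 2 / 2)) ≤ T := by
    refine le_of_pow_le_pow_left₀ two_ne_zero hT0.le ?_
    rw [hT2, mul_pow, mul_pow, Real.sq_sqrt hs1.le, hS2, Finset.sum_mul]
    have e : Real.exp (-s ^ 2 / 2) ^ 2 = Real.exp (-s ^ 2) := by
      rw [← Real.exp_nat_mul]; congr 1; push_cast; ring
    rw [e]
    exact Finset.sum_le_sum fun i _ => hvle i
  have hBE := isBerryEsseenConstant_C3 (Fin n → ℝ) P n X hn hXm hind hnd h3 h0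
  set K := ∑ i, ∫ ω, |X i ω| ^ 3 ∂P with hK
  have hKle : K ≤ 8 * (Real.exp s * (B * S ^ 2)) := by
    refine (Finset.sum_le_sum fun i _ => h3le i).trans_eq ?_
    rw [hS2]; simp only [Finset.mul_sum]
  have hK0 : 0 < K := Finset.sum_pos (fun i _ => (pow_pos (Real.sqrt_pos.2 (hvpos i)) 3).trans_le
    (sqrt_cube_le (hXm i) (h3 i))) Finset.univ_nonempty
  have hC3 : 0 ≤ C3 := by
    have h1 := (abs_nonneg _).trans (hBE 0)
    exact nonneg_of_mul_nonneg_left h1 (div_pos hK0 (pow_pos hT0 3))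
  refine ⟨hC3, T, hTS, ?_⟩
  set Z : (Fin n → ℝ) → ℝ := fun ω => (∑ i, ω i - c) / T with hZ
  have hZm : Measurable Z := by fun_prop
  have hsum : ∀ ω, ∑ i, X i ω = ∑ i, ω i - c := fun ω => by
    rw [← hc, ← Finset.sum_sub_distrib]
  have := Measure.isProbabilityMeasure_map (μ := P) hZm.aemeasurable
  have hΔ : ∀ z, |(P.map Z).real (Set.Iic z) - Phi z| ≤ C3 * (K / T ^ 3) := by
    intro z
    rw [map_measureReal_apply hZm measurableSet_Iic]
    convert hBE z using 4
    ext ω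
    rw [Set.mem_preimage, Set.mem_Iic, hZ, Set.mem_ofPred_eq, hsum, div_le_iff₀ hT0]
  have hmain := integral_expPos_le hΔ (mul_nonneg hl hT0.le)
  rw [integral_map hZm.aemeasurable (measurable_expPos _).aestronglyMeasurable] at hmain
  have e : ∀ ω, expPos (l * T) (Z ω) = expPos l (∑ i, ω i - c) := fun ω => by
    have h1 : l * T * Z ω = l * (∑ i, ω i - c) := by simp only [hZ]; field_simp
    have h2 : 0 < Z ω ↔ 0 < ∑ i, ω i - c := div_pos_iff_of_pos_right hT0
    simp only [expPos, Set.indicator, Set.mem_Ioi, h1, h2]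
  simp only [e] at hmain
  refine hmain.trans ?_
  have : K / T ^ 3 ≤ 8 * (Real.exp s * (B * S ^ 2)) / T ^ 3 :=
    div_le_div_of_nonneg_right hKle (pow_pos hT0 3).le
  have := mul_le_mul_of_nonneg_left this hC3
  linarith

/-- The Berry–Esseen term, rewritten with the lower bound for the tilted standard deviation. -/
lemma third_moment_ratio_le {s t S T : ℝ} (hst : s ≤ t) (hs0 : 0 ≤ s) (ht : t ≤ 1 / 2)
    (hS : 0 < S) (hB : 0 < B) (hT : S * (√(1 - s) * Real.exp (-s ^ 2 / 2)) ≤ T) :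
    8 * (Real.exp s * (B * S ^ 2)) / T ^ 3
      ≤ 8 * (Real.exp (t + t ^ 2) / (1 - t) * (Real.exp (1 / 2 * t ^ 2) / √(1 - t)))
        * (B / S) := by
  have h1t : 0 < 1 - t := by linarith
  set r := √(1 - t) with hr
  have hr0 : 0 < r := Real.sqrt_pos.2 h1t
  have hr2 : r ^ 2 = 1 - t := Real.sq_sqrt h1t.le
  set F := Real.exp (-t ^ 2 / 2) with hF
  have hF0 : 0 < F := Real.exp_pos _
  have hT' : S * (r * F) ≤ T := by
    refine le_trans ?_ hT
    have h1 : r ≤ √(1 - s) := Real.sqrt_le_sqrt (by linarith)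
    have h2 : F ≤ Real.exp (-s ^ 2 / 2) := Real.exp_le_exp.2 (by
      have := pow_le_pow_left₀ hs0 hst 2; linarith)
    exact mul_le_mul_of_nonneg_left (mul_le_mul h1 h2 hF0.le (Real.sqrt_nonneg _)) hS.le
  have hT3 : (S * (r * F)) ^ 3 ≤ T ^ 3 := pow_le_pow_left₀ (by positivity) hT' 3
  have h1 : 8 * (Real.exp s * (B * S ^ 2)) / T ^ 3
      ≤ 8 * (Real.exp t * (B * S ^ 2)) / (S * (r * F)) ^ 3 := by
    have : Real.exp s ≤ Real.exp t := Real.exp_le_exp.2 hst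
    gcongr
  refine h1.trans (le_of_eq ?_)
  have hF3 : Real.exp (t + t ^ 2) * Real.exp (1 / 2 * t ^ 2) * F ^ 3 = Real.exp t := by
    rw [hF, ← Real.exp_nat_mul, ← Real.exp_add, ← Real.exp_add]; congr 1; push_cast; ring
  rw [← hF3, ← hr2]
  field_simp

lemma pi_tail_le (hn : 0 < n) (h : ∀ i, Summand (ν i) (σ i) B) (hB : 0 < B) {x S : ℝ}
    (hx : 0 ≤ x) (hS : 0 < S) (hS2 : S ^ 2 = ∑ i, σ i ^ 2) (hxS : x < 0.25 * (S / B)) :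
    (Measure.pi ν).real {ω | x * S < ∑ i, ω i}
      ≤ (1 - Phi x) * (1 + cFactor (tParam (x * B / S)) * (1 + x) * (B / S)) := by
  have hu0 : 0 ≤ x * B / S := by positivity
  have hu4 : x * B / S < 1 / 4 := by
    rw [div_lt_iff₀ hS]
    have : x * B < 0.25 * (S / B) * B := mul_lt_mul_of_pos_right hxS hB
    rw [mul_assoc, div_mul_cancel₀ _ hB.ne'] at this
    linarith
  obtain ⟨ht0, ht2, ht⟩ := tParam_spec hu0 hu4
  set t := tParam (x * B / S)
  obtain ⟨l, ⟨hl, hlt⟩, hc⟩ := exists_saddle h hB hx hS hS2 ht0 (by linarith) ht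
  have hst : l * B ≤ t := by rwa [le_div_iff₀ hB] at hlt
  have hs0 : 0 ≤ l * B := mul_nonneg hl hB.le
  obtain ⟨hC3, T, hT, hI⟩ := tilted_integral_le hn h hl (hst.trans ht2.le) hS2 hc
  have hmom := third_moment_ratio_le hst hs0 ht2.le hS hB hT
  rw [tail_eq_tilted h hl]
  have hpref := prod_mgf_le h hl hx hS hS2 hc
  have hI0 : 0 ≤ ∫ ω, expPos l (∑ i, ω i - x * S)
      ∂(Measure.pi fun i => (ν i).tilted fun x => l * x) :=
    integral_nonneg fun ω => expPos_nonneg _ _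
  refine (mul_le_mul_of_nonneg_right hpref hI0).trans ?_
  rw [one_sub_Phi_eq, mul_div_assoc, mul_assoc]
  refine mul_le_mul_of_nonneg_left (hI.trans ?_) (Real.exp_pos _).le
  -- comparison of the Mills ratios at `l T` and at `x`
  set s := l * B with hs
  set R := 1 + √2 * s * Real.exp (s + s ^ 2) with hR
  have hR1 : 1 ≤ R := by
    have : 0 ≤ √2 * s * Real.exp (s + s ^ 2) := by positivity
    linarith
  have hT0 : 0 ≤ T := le_trans (by positivity) hT
  have hxy : x ≤ l * T * R := by
    have h1 : x * S ≤ l * S ^ 2 * (1 + s / 2 + s ^ 2 / 4) := by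
      rw [← hc, hS2, Finset.mul_sum, Finset.sum_mul]
      exact Finset.sum_le_sum fun i _ => (h i).tilted_mean_upper hl (by linarith)
    have h2 : x ≤ l * S * (1 + s / 2 + s ^ 2 / 4) := by
      refine le_of_mul_le_mul_right (h1.trans_eq ?_) hS
      ring
    refine h2.trans ((mul_le_mul_of_nonneg_left (mean_bound_le hs0 (hst.trans ht2.le))
      (mul_nonneg hl hS.le)).trans ?_)
    have h3 := mul_le_mul_of_nonneg_left hT hl
    have h4 := mul_le_mul_of_nonneg_right h3 (zero_le_one.trans hR1)
    refine le_trans (le_of_eq ?_) h4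
    ring
  have hM := mills_le_of_le_mul (mul_nonneg hl hT0) hR1 hxy
  set q := √(2 * Real.pi) with hq
  have hq0 : 0 < q := sqrt_two_pi_pos
  set G := Real.exp (t + t ^ 2) / (1 - t) with hG
  set H := Real.exp (1 / 2 * t ^ 2) / √(1 - t) with hH
  have h1t : 0 < 1 - t := by linarith
  have hG0 : 0 ≤ G := by positivity
  have hH0 : 0 ≤ H := by positivity
  have hBS : 0 < B / S := div_pos hB hS
  have hMx := mills_pos x
  -- `t (1 - t) = x B / σ` turns the relative error `√2 s e^{s + s²}` into a multiple of `B / σ`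
  have hRG : R ≤ 1 + G * √2 * ((1 + x) * (B / S)) := by
    have h1 : s * Real.exp (s + s ^ 2) ≤ t * Real.exp (t + t ^ 2) := by
      have := pow_le_pow_left₀ hs0 hst 2
      exact mul_le_mul hst (Real.exp_le_exp.2 (by linarith)) (Real.exp_pos _).le ht0
    have h2 : t * Real.exp (t + t ^ 2) = G * (x * (B / S)) := by
      rw [← mul_div_assoc x B S, ← ht, hG]; field_simp
    have h3 : G * (x * (B / S)) ≤ G * ((1 + x) * (B / S)) :=
      mul_le_mul_of_nonneg_left (mul_le_mul_of_nonneg_right (by linarith) hBS.le) hG0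
    have h4 := mul_le_mul_of_nonneg_left (h1.trans (h2.trans_le h3)) (Real.sqrt_nonneg 2)
    rw [hR]; linarith
  have hΔ : 2 * (C3 * (8 * (Real.exp s * (B * S ^ 2)) / T ^ 3))
      ≤ mills x / q * (16 * q * C3 * (G * H) * ((1 + x) * (B / S))) := by
    have h1 := mul_le_mul_of_nonneg_left hmom (mul_nonneg zero_le_two hC3)
    have h2 := one_le_one_add_mul_mills hx
    have h3 : 0 ≤ 16 * C3 * (G * H) * (B / S) := by positivity
    have h4 := mul_le_mul_of_nonneg_left h2 h3
    have e : mills x / q * (16 * q * C3 * (G * H) * ((1 + x) * (B / S)))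
        = 16 * C3 * (G * H) * (B / S) * ((1 + x) * mills x) := by field_simp
    rw [e]
    linarith
  have hM' : mills (l * T) / q ≤ mills x / q * (1 + G * √2 * ((1 + x) * (B / S))) := by
    rw [div_mul_eq_mul_div]
    exact div_le_div_of_nonneg_right (hM.trans (mul_le_mul_of_nonneg_left hRG hMx.le)) hq0.le
  refine (add_le_add hM' hΔ).trans (le_of_eq ?_)
  have e : cFactor t = G * (√2 + 16 * q * C3 * H) := by
    rw [cFactor, hG, hH, hq, mul_div_assoc]
  rw [e]; ring

end Tail

lemma summand_map {Ω : Type*} [MeasurableSpace Ω] {μ : Measure Ω} [IsProbabilityMeasure μ]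
    {X : Ω → ℝ} {B : ℝ} (hX : Measurable X) (hnd : NonDegenerate μ X)
    (h3 : Integrable (fun ω => |X ω| ^ 3) μ) (h0 : ∫ ω, X ω ∂μ = 0)
    (hle : ∀ᵐ ω ∂μ, X ω ≤ sd μ X) (hB : ∫ ω, |X ω| ^ 3 ∂μ ≤ B * ∫ ω, X ω ^ 2 ∂μ) :
    Summand (μ.map X) (sd μ X) B := by
  have hsq : sd μ X ^ 2 = ∫ ω, X ω ^ 2 ∂μ := Real.sq_sqrt (integral_sq_nonneg X)
  have hm3 : Measurable fun x : ℝ => |x| ^ 3 := by fun_prop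
  refine ⟨Measure.isProbabilityMeasure_map hX.aemeasurable,
    Real.sqrt_pos.2 (integral_sq_pos hX h3 hnd), ?_, ?_, ?_, ?_, ?_⟩
  · exact (integrable_map_measure hm3.aestronglyMeasurable hX.aemeasurable).2 h3
  · rw [integral_map hX.aemeasurable (by fun_prop), h0]
  · rw [integral_map hX.aemeasurable (by fun_prop), hsq]
  · exact (ae_map_iff hX.aemeasurable measurableSet_Iic).2 hle
  · rw [integral_map hX.aemeasurable (by fun_prop), hsq]; exact hB

theorem tail_le {Ω : Type*} [MeasurableSpace Ω] {μ : Measure Ω} [IsProbabilityMeasure μ]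
    {n : ℕ} {ξ : Fin n → Ω → ℝ} {B : ℝ} (hB : 0 < B) (hξ : ∀ i, Measurable (ξ i))
    (hind : iIndepFun ξ μ) (hnd : ∀ i, NonDegenerate μ (ξ i))
    (h3 : ∀ i, Integrable (fun ω => |ξ i ω| ^ 3) μ) (h0 : ∀ i, ∫ ω, ξ i ω ∂μ = 0)
    (hle : ∀ i, ∀ᵐ ω ∂μ, ξ i ω ≤ sd μ (ξ i))
    (hmom : ∀ i, ∫ ω, |ξ i ω| ^ 3 ∂μ ≤ B * ∫ ω, ξ i ω ^ 2 ∂μ)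
    {x : ℝ} (hx : 0 ≤ x) (hxB : x < 0.25 * (sdSum μ ξ / B)) :
    μ.real {ω | x * sdSum μ ξ < ∑ i, ξ i ω}
      ≤ (1 - Phi x) * (1 + cFactor (tParam (x * B / sdSum μ ξ)) * (1 + x)
        * (B / sdSum μ ξ)) := by
  have hS : 0 < sdSum μ ξ := by
    have h1 : 0 < 0.25 * (sdSum μ ξ / B) := hx.trans_lt hxB
    have h2 : 0 < sdSum μ ξ / B := by linarith
    exact (div_pos_iff_of_pos_right hB).1 h2
  have hn : 0 < n := by
    rcases Nat.eq_zero_or_pos n with rfl | hn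
    · simp [sdSum] at hS
    · exact hn
  have hsum := fun i => summand_map (hξ i) (hnd i) (h3 i) (h0 i) (hle i) (hmom i)
  have hS2 : sdSum μ ξ ^ 2 = ∑ i, sd μ (ξ i) ^ 2 := by
    rw [sdSum, Real.sq_sqrt (Finset.sum_nonneg fun i _ => integral_sq_nonneg _)]
    exact Finset.sum_congr rfl fun i _ => (Real.sq_sqrt (integral_sq_nonneg _)).symm
  have h := pi_tail_le hn hsum hB hx hS hS2 hxB
  rw [← (iIndepFun_iff_map_fun_eq_pi_map fun i => (hξ i).aemeasurable).1 hind,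
    map_measureReal_apply (by fun_prop)
      (measurableSet_lt measurable_const (by fun_prop))] at h
  exact h

/-! ### The i.i.d. case -/

lemma exists_cFactor_bound : ∃ K : ℝ, 0 ≤ K ∧ ∀ t ∈ Set.Icc (0 : ℝ) (1 / 2), cFactor t ≤ K := by
  have hcont : ContinuousOn cFactor (Set.Icc 0 (1 / 2)) := by
    have h1 : ∀ t ∈ Set.Icc (0 : ℝ) (1 / 2), 1 - t ≠ 0 := fun t ht => by linarith [ht.2]
    have h2 : ∀ t ∈ Set.Icc (0 : ℝ) (1 / 2), √(1 - t) ≠ 0 := fun t ht =>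
      (Real.sqrt_pos.2 (by linarith [ht.2])).ne'
    unfold cFactor
    fun_prop (disch := assumption)
  obtain ⟨K, hK⟩ := isCompact_Icc.exists_bound_of_continuousOn hcont
  have h0 := hK 0 ⟨le_rfl, by norm_num⟩
  exact ⟨K, (norm_nonneg _).trans h0, fun t ht => (le_abs_self _).trans (hK t ht)⟩

/-- The uniform version for an i.i.d. sequence. For the finitely many `n` with
`a n ≥ σ / (4 B)` the bound holds because `1 - Φ` is bounded below on `[0, a n]`. -/
theorem iid_tail_le {Ω : Type*} [MeasurableSpace Ω] {μ : Measure Ω} [IsProbabilityMeasure μ]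
    {ξ : ℕ → Ω → ℝ} {B : ℝ} (hB : 0 < B) (hξ : ∀ i, Measurable (ξ i))
    (hind : iIndepFun ξ μ) (hid : ∀ i, IdentDistrib (ξ i) (ξ 0) μ μ)
    (hnd : NonDegenerate μ (ξ 0)) (h3 : Integrable (fun ω => |ξ 0 ω| ^ 3) μ)
    (h0 : ∫ ω, ξ 0 ω ∂μ = 0) (hle : ∀ᵐ ω ∂μ, ξ 0 ω ≤ sd μ (ξ 0))
    (hmom : ∫ ω, |ξ 0 ω| ^ 3 ∂μ ≤ B * ∫ ω, ξ 0 ω ^ 2 ∂μ)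
    {a : ℕ → ℝ} (ha : a =o[atTop] fun n : ℕ => √(n : ℝ)) :
    ∃ ε : ℕ → ℝ, Tendsto ε atTop (nhds 0) ∧
      ∀ (n : ℕ) (x : ℝ), 0 ≤ x → x ≤ a n →
        μ.real {ω | x * sdSum μ (fun i : Fin n => ξ i) < ∑ i : Fin n, ξ i ω}
          ≤ (1 - Phi x) * (1 + ε n) := by
  obtain ⟨K, hK0, hK⟩ := exists_cFactor_bound
  set τ := sd μ (ξ 0) with hτ
  have hτ0 : 0 < τ := Real.sqrt_pos.2 (integral_sq_pos (hξ 0) h3 hnd)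
  have hsq : ∀ i, ∫ ω, ξ i ω ^ 2 ∂μ = ∫ ω, ξ 0 ω ^ 2 ∂μ := fun i =>
    ((hid i).comp (u := fun x => x ^ 2) (by fun_prop)).integral_eq
  have hcube : ∀ i, ∫ ω, |ξ i ω| ^ 3 ∂μ = ∫ ω, |ξ 0 ω| ^ 3 ∂μ := fun i =>
    ((hid i).comp (u := fun x => |x| ^ 3) (by fun_prop)).integral_eq
  have hsd : ∀ i, sd μ (ξ i) = τ := fun i => by rw [hτ, sd, sd, hsq i]
  have hS : ∀ n : ℕ, sdSum μ (fun i : Fin n => ξ i) = √(n : ℝ) * τ := fun n => by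
    simp only [sdSum, hsq, Finset.sum_const, Finset.card_univ, Fintype.card_fin, nsmul_eq_mul]
    rw [Real.sqrt_mul (Nat.cast_nonneg n), hτ, sd]
  have hndi : ∀ i, NonDegenerate μ (ξ i) := fun i ⟨c, hc⟩ => hnd ⟨c, by
    exact ((hid i).ae_mem_snd (measurableSet_singleton c) hc)⟩
  have htail : ∀ (n : ℕ) (x : ℝ), 0 ≤ x → x < 0.25 * (√(n : ℝ) * τ / B) →
      μ.real {ω | x * sdSum μ (fun i : Fin n => ξ i) < ∑ i : Fin n, ξ i ω}
        ≤ (1 - Phi x) * (1 + K * (1 + x) * (B / (√(n : ℝ) * τ))) := by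
    intro n x hx hxn
    have h := tail_le (ξ := fun i : Fin n => ξ i) (μ := μ) hB (fun i => hξ i)
      (hind.precomp Fin.val_injective) (fun i => hndi i)
      (fun i => ((hid i).comp (u := fun x => |x| ^ 3) (by fun_prop)).integrable_iff.2 h3)
      (fun i => (hid i).integral_eq.trans h0)
      (fun i => by
        rw [hsd]
        exact (hid i).symm.ae_mem_snd measurableSet_Iic hle)
      (fun i => by rw [hcube, hsq]; exact hmom) hx (by rw [hS]; exact hxn)
    rw [hS] at h ⊢
    refine h.trans (mul_le_mul_of_nonneg_left ?_ (sub_nonneg.2 (Phi_lt_one x).le))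
    have hpos : 0 < √(n : ℝ) * τ := by
      have h1 : 0 < √(n : ℝ) * τ / B := by linarith
      exact (div_pos_iff_of_pos_right hB).1 h1
    have hu4 : x * B / (√(n : ℝ) * τ) < 1 / 4 := by
      rw [div_lt_iff₀ hpos]
      have h2 : x * B < 0.25 * (√(n : ℝ) * τ / B) * B := mul_lt_mul_of_pos_right hxn hB
      rw [mul_assoc, div_mul_cancel₀ _ hB.ne'] at h2
      linarith
    obtain ⟨t0, t1, -⟩ := tParam_spec (by positivity) hu4
    have := hK _ ⟨t0, t1.le⟩
    gcongr
  classical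
  set ε : ℕ → ℝ := fun n =>
    if a n < 0.25 * (√(n : ℝ) * τ / B) then K * (1 + |a n|) * (B / (√(n : ℝ) * τ))
    else 1 / (1 - Phi (a n)) with hε
  refine ⟨ε, ?_, ?_⟩
  · have hsqrt : Tendsto (fun n : ℕ => √(n : ℝ)) atTop atTop :=
      Real.tendsto_sqrt_atTop.comp tendsto_natCast_atTop_atTop
    have hev : ∀ᶠ n : ℕ in atTop, a n < 0.25 * (√(n : ℝ) * τ / B) := by
      have hc : 0 < 0.125 * (τ / B) := by positivity
      filter_upwards [ha.bound hc, hsqrt.eventually_gt_atTop 0] with n hn hpos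
      rw [Real.norm_eq_abs, Real.norm_eq_abs, abs_of_pos hpos] at hn
      have h1 : 0 < √(n : ℝ) * (τ / B) := by positivity
      have h2 : √(n : ℝ) * τ / B = √(n : ℝ) * (τ / B) := mul_div_assoc _ _ _
      rw [h2]
      linarith [le_abs_self (a n)]
    have hlim : Tendsto (fun n : ℕ => K * (B / τ) * ((√(n : ℝ))⁻¹ + |a n / √(n : ℝ)|)) atTop
        (nhds 0) := by
      have h1 : Tendsto (fun n : ℕ => a n / √(n : ℝ)) atTop (nhds 0) := ha.tendsto_div_nhds_zero
      have h2 := (hsqrt.inv_tendsto_atTop.add h1.abs).const_mul (K * (B / τ))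
      simpa using h2
    refine hlim.congr' ?_
    filter_upwards [hev] with n hn
    rw [hε]
    simp only [if_pos hn]
    rw [abs_div, abs_of_nonneg (Real.sqrt_nonneg _)]
    ring
  · intro n x hx hxa
    simp only [hε]
    split_ifs with hn
    · refine (htail n x hx (hxa.trans_lt hn)).trans
        (mul_le_mul_of_nonneg_left ?_ (sub_nonneg.2 (Phi_lt_one x).le))
      have h1 : x ≤ |a n| := hxa.trans (le_abs_self _)
      have h2 : 0 ≤ B / (√(n : ℝ) * τ) := by positivity
      gcongr
    · have h1 : 0 < 1 - Phi (a n) := sub_pos.2 (Phi_lt_one _)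
      have h2 : 1 - Phi (a n) ≤ 1 - Phi x := by linarith [Phi_mono hxa]
      have h3 : 1 ≤ (1 - Phi x) * (1 / (1 - Phi (a n))) := by
        rw [mul_one_div, one_le_div h1]; exact h2
      refine measureReal_le_one.trans (h3.trans ?_)
      rw [mul_add]
      linarith

end SubGaussianTail

end

theorem theorem2p2 {Ω : Type*} [MeasurableSpace Ω] (μ : Measure Ω) [IsProbabilityMeasure μ] :
    -- the bound for independent summands
    (∀ (n : ℕ) (ξ : Fin n → Ω → ℝ) (B : ℝ), 0 < B →
      (∀ i, Measurable (ξ i)) → iIndepFun ξ μ →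
      (∀ i, SubGaussianTail.NonDegenerate μ (ξ i)) →
      (∀ i, Integrable (fun ω => |ξ i ω| ^ 3) μ) →
      (∀ i, ∫ ω, ξ i ω ∂μ = 0) →
      (∀ i, ∀ᵐ ω ∂μ, ξ i ω ≤ SubGaussianTail.sd μ (ξ i)) →
      (∀ i, ∫ ω, |ξ i ω| ^ 3 ∂μ ≤ B * ∫ ω, ξ i ω ^ 2 ∂μ) →
      ∀ x : ℝ, 0 ≤ x → x < 0.25 * (SubGaussianTail.sdSum μ ξ / B) →
        μ.real {ω | x * SubGaussianTail.sdSum μ ξ < ∑ i, ξ i ω}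
          ≤ (1 - SubGaussianTail.Phi x) *
            (1 + SubGaussianTail.cFactor
                  (SubGaussianTail.tParam (x * B / SubGaussianTail.sdSum μ ξ))
                * (1 + x) * (B / SubGaussianTail.sdSum μ ξ))) ∧
    -- the i.i.d. case, uniformly over `0 ≤ x ≤ a n` whenever `a n = o(√n)`
    (∀ (ξ : ℕ → Ω → ℝ) (B : ℝ), 0 < B →
      (∀ i, Measurable (ξ i)) → iIndepFun ξ μ →
      (∀ i, IdentDistrib (ξ i) (ξ 0) μ μ) →
      SubGaussianTail.NonDegenerate μ (ξ 0) →
      Integrable (fun ω => |ξ 0 ω| ^ 3) μ →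
      ∫ ω, ξ 0 ω ∂μ = 0 →
      (∀ᵐ ω ∂μ, ξ 0 ω ≤ SubGaussianTail.sd μ (ξ 0)) →
      ∫ ω, |ξ 0 ω| ^ 3 ∂μ ≤ B * ∫ ω, ξ 0 ω ^ 2 ∂μ →
      ∀ a : ℕ → ℝ, (a =o[atTop] fun n : ℕ => √(n : ℝ)) →
        ∃ ε : ℕ → ℝ, Tendsto ε atTop (nhds 0) ∧
          ∀ (n : ℕ) (x : ℝ), 0 ≤ x → x ≤ a n →
            μ.real {ω | x * SubGaussianTail.sdSum μ (fun i : Fin n => ξ i) < ∑ i : Fin n, ξ i ω}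
              ≤ (1 - SubGaussianTail.Phi x) * (1 + ε n)) := by
  exact ⟨fun _ _ _ hB hξ hind hnd h3 h0 hle hmom _ hx hxB =>
      SubGaussianTail.tail_le hB hξ hind hnd h3 h0 hle hmom hx hxB,
    fun _ _ hB hξ hind hid hnd h3 h0 hle hmom _ ha =>
      SubGaussianTail.iid_tail_le hB hξ hind hid hnd h3 h0 hle hmom ha⟩
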